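/- Let $d_A,d_B$ be integers with $2\le d_A\le d_B$. For $\alpha,\beta,\gamma\in\mathbb{R}$ let $\Phi[\alpha,\beta,\gamma]$ be the linear map on the complex matrices acting on $AB=\mathbb{C}^{d_A}\otimes\mathbb{C}^{d_B}$ given by $$\Phi[\alpha,\beta,\gamma](X)=(\operatorname{Tr}X)\,\mathbb{1}_{AB}+\alpha\,\mathbb{1}_A\otimes\operatorname{Tr}_A X+\beta\,\operatorname{Tr}_B X\otimes\mathbb{1}_B+\gamma X .$$ A map $L$ is called entanglement-breaking if it is completely positive and, for every $k$ and every positive semidefinite $\rho$ on $AB\otimes\mathbb{C}^k$, the matrix $(L\otimes \mathrm{id}_k)(\rho)$ is separable across the cut $AB\,|\,\mathbb{C}^k$, i.e. it is a finite sum $\sum_i P_i\otimes Q_i$ with all $P_i,Q_i$ positive semidefinite. (1) $\Phi[\alpha,\beta,\gamma]$ is entanglement-breaking if and only if all of the following hold: $$\alpha\ge-\tfrac1{d_B},\qquad 1+d_B\alpha+d_A\beta+d_Ad_B\gamma\ge0,$$ $$1-\alpha+\beta-\gamma\ge0,\qquad 1+\alpha-\beta-\gamma\ge0,\qquad 1-\alpha-\beta+\gamma\ge0,$$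 $$(d_Ad_B-1)(d_A\beta+1)-(d_B-d_A)(\alpha+d_A\gamma)\ge0 .$$ (2) If $d_A=d_B$, the last inequality can be replaced by the bound $\beta\ge-\frac1{d_A}$: then $\Phi[\alpha,\beta,\gamma]$ is entanglement-breaking if and only if $\alpha\ge-\frac1{d_B}$, $\beta\ge-\frac1{d_A}$, $1+d_B\alpha+d_A\beta+d_Ad_B\gamma\ge0$ and the three inequalities of the second line hold. (3) The solid in $(\alpha,\beta,\gamma)$-space described by the system in (1) is a convex double pyramid with triangular basis. The basis is the nondegenerate triangle with vertices $$\left(-\tfrac1{d_B},-\tfrac1{d_B},1\right),\quad\left(1,-\tfrac1{d_A},-\tfrac1{d_A}\right),\quad\left(-\tfrac1{d_B},1,-\tfrac1{d_B}\right),$$ and the culminating vertices of the two pyramids are $$\left(-\tfrac1{d_B},-\tfrac1{d_A},\tfrac1{d_Ad_B}\right),\qquad(1,1,1).$$ That is, the solid is the union of the two nondegenerate tetrahedra with this basis and these apices, the two tetrahedra meet exactly in the basis, and the extreme points of the solid are exactly these five points. -/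

import Mathlib

open scoped Kronecker ComplexOrder

/-- The partial trace over the first tensor factor. -/
def partialTraceLeft {m n : Type*} [Fintype m] :
    Matrix (m × n) (m × n) ℂ →ₗ[ℂ] Matrix n n ℂ where
  toFun X := Matrix.of fun b b' => ∑ a, X (a, b) (a, b')
  map_add' X Y := by
    ext b b'
    simp [Finset.sum_add_distrib]
  map_smul' c X := by
    ext b b'
    simp [Finset.mul_sum]

/-- The partial trace over the second tensor factor. -/
def partialTraceRight {m n : Type*} [Fintype n] :
    Matrix (m × n) (m × n) ℂ →ₗ[ℂ] Matrix m m ℂ where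
  toFun X := Matrix.of fun a a' => ∑ b, X (a, b) (a', b)
  map_add' X Y := by
    ext a a'
    simp [Finset.sum_add_distrib]
  map_smul' c X := by
    ext a a'
    simp [Finset.mul_sum]

/-- The bipartite depolarizing map `Φ[α, β, γ]` on the system `AB`:
`X ↦ (Tr X) 1 + α 1_A ⊗ Tr_A X + β Tr_B X ⊗ 1_B + γ X`. -/
def bipartiteDepolarizing (dA dB : ℕ) (α β γ : ℝ) :
    Matrix (Fin dA × Fin dB) (Fin dA × Fin dB) ℂ →ₗ[ℂ]
      Matrix (Fin dA × Fin dB) (Fin dA × Fin dB) ℂ where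
  toFun X :=
    X.trace • (1 : Matrix (Fin dA × Fin dB) (Fin dA × Fin dB) ℂ)
      + (α : ℂ) • ((1 : Matrix (Fin dA) (Fin dA) ℂ) ⊗ₖ partialTraceLeft X)
      + (β : ℂ) • (partialTraceRight X ⊗ₖ (1 : Matrix (Fin dB) (Fin dB) ℂ))
      + (γ : ℂ) • X
  map_add' X Y := by
    simp only [Matrix.trace_add, map_add, Matrix.kronecker_add, Matrix.add_kronecker, smul_add,
      add_smul]
    abel
  map_smul' c X := by
    simp only [Matrix.trace_smul, map_smul, Matrix.kronecker_smul, Matrix.smul_kronecker,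
      RingHom.id_apply, smul_add, smul_eq_mul, mul_smul]
    simp only [smul_comm c]

/-- The map `L ⊗ id` on matrices over the system with a `k`-dimensional ancilla. -/
def ampliate {n : Type*} (L : Matrix n n ℂ →ₗ[ℂ] Matrix n n ℂ) (k : ℕ)
    (ρ : Matrix (n × Fin k) (n × Fin k) ℂ) : Matrix (n × Fin k) (n × Fin k) ℂ :=
  Matrix.of fun x y => L (Matrix.of fun p q => ρ (p, x.2) (q, y.2)) x.1 y.1

/-- Complete positivity: `L ⊗ id_k` preserves positive semidefiniteness for every `k`. -/
def IsCompletelyPositiveMap {n : Type*} (L : Matrix n n ℂ →ₗ[ℂ] Matrix n n ℂ) : Prop :=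
  ∀ (k : ℕ) (ρ : Matrix (n × Fin k) (n × Fin k) ℂ), ρ.PosSemidef → (ampliate L k ρ).PosSemidef

/-- Separability of a (not necessarily normalized) bipartite matrix: it is a finite sum of tensor
products of positive semidefinite matrices. -/
def IsSeparableMatrix {m n : Type*} (ρ : Matrix (m × n) (m × n) ℂ) : Prop :=
  ∃ (r : ℕ) (P : Fin r → Matrix m m ℂ) (Q : Fin r → Matrix n n ℂ),
    (∀ i, (P i).PosSemidef) ∧ (∀ i, (Q i).PosSemidef) ∧ ρ = ∑ i, P i ⊗ₖ Q i

/-- A map is entanglement-breaking if it is completely positive and, for every finite-dimensional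
ancilla and every (unnormalized) joint state `ρ` of system and ancilla, `(L ⊗ id) ρ` is separable
across the cut system | ancilla. -/
def IsEntanglementBreaking {n : Type*} (L : Matrix n n ℂ →ₗ[ℂ] Matrix n n ℂ) : Prop :=
  IsCompletelyPositiveMap L ∧
    ∀ (k : ℕ) (ρ : Matrix (n × Fin k) (n × Fin k) ℂ),
      ρ.PosSemidef → IsSeparableMatrix (ampliate L k ρ)

/-- The subset of the `(α, β, γ)`-space cut out by the six linear inequalities. -/
def ebSolid (dA dB : ℕ) : Set (Fin 3 → ℝ) :=
  {x | -(1 / (dB : ℝ)) ≤ x 0 ∧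
    0 ≤ 1 + (dB : ℝ) * x 0 + (dA : ℝ) * x 1 + (dA : ℝ) * (dB : ℝ) * x 2 ∧
    0 ≤ 1 - x 0 + x 1 - x 2 ∧
    0 ≤ 1 + x 0 - x 1 - x 2 ∧
    0 ≤ 1 - x 0 - x 1 + x 2 ∧
    0 ≤ ((dA : ℝ) * (dB : ℝ) - 1) * ((dA : ℝ) * x 1 + 1)
      - ((dB : ℝ) - (dA : ℝ)) * (x 0 + (dA : ℝ) * x 2)}

/-- `S` is a convex double pyramid over the (nondegenerate) triangle with vertices `u, v, w`, with
culminating vertices `p` and `q`: it is the union of two nondegenerate tetrahedra with that common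
base and apices `p`, `q`, which meet exactly in the base, and its vertices (extreme points) are
exactly the five given points. -/
def IsTriangularDoublePyramid (S : Set (Fin 3 → ℝ)) (u v w p q : Fin 3 → ℝ) : Prop :=
  Convex ℝ S ∧
  AffineIndependent ℝ ![u, v, w, p] ∧
  AffineIndependent ℝ ![u, v, w, q] ∧
  S = convexHull ℝ {u, v, w, p} ∪ convexHull ℝ {u, v, w, q} ∧
  convexHull ℝ {u, v, w, p} ∩ convexHull ℝ {u, v, w, q} = convexHull ℝ {u, v, w} ∧
  S.extremePoints ℝ = {u, v, w, p, q}

/-!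
The Choi matrix of a linear map, written as a kernel with four indices, is a sum of tensor products
of positive semidefinite matrices if and only if the map is entanglement-breaking
(`isEntanglementBreaking_iff`). For `Φ[α, β, γ]` this kernel is
`A₁B₁ + α A₁B₂ + β A₂B₁ + γ A₂B₂`, where index `1` stands for the completely depolarizing map of a
factor and index `2` for its identity map (`choiKernel_bipartiteDepolarizing`).

The inequalities are necessary because each is the expectation of an operator that is nonnegative on
product vectors. Two come from complete positivity, and three from the positivity of the partial
transpose, where the products `(1 ± F_A)(1 ± F_B)` of swaps occur (`witness_swap_nonneg`). The last
one, which is not a consequence of positivity of the partial transpose when the dimensions differ,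
expresses that a square matrix `K` factoring through `m` dimensions satisfies `|tr K|² ≤ m ‖K‖²`
(`norm_trace_sq_le`).

They are sufficient because the solid is the union of two tetrahedra
(`isTriangularDoublePyramid_ebSolid`), whose five vertices have separable kernels. Four vertices are
tensor products of the maps `X ↦ (Tr X) 1 + X` and `X ↦ (Tr X) 1 - X / d` of the factors
(`add_mem_separableKernels`, `sub_mem_separableKernels`). The vertex `(-1/n, -1/n, 1)` is an average
of measure-and-prepare maps in maximally entangled vectors of Schmidt rank `m`, given by an explicit
finite ensemble (`entangled_vertex_mem_separableKernels`).
-/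

/-! ### Kernels of linear maps and the cone of separable kernels -/

/-- The Choi matrix of a linear map `L`, as a function of four indices:
`choiKernel L x y p q` is the `(x, y)` entry of `L E_{pq}`. -/
def choiKernel {n : Type*} [DecidableEq n] (L : Matrix n n ℂ →ₗ[ℂ] Matrix n n ℂ) :
    n → n → n → n → ℂ :=
  fun x y p q => L (Matrix.single p q 1) x y

/-- The kernel of the measure-and-prepare map `X ↦ ⟨w, X w⟩ v v*`. -/
def pureKernel {n : Type*} (v w : n → ℂ) : n → n → n → n → ℂ :=
  fun x y p q => v x * star (v y) * (star (w p) * w q)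

/-- The cone of kernels that are finite sums of pure measure-and-prepare kernels. It is closed
under multiplication by nonnegative reals because these can be absorbed into a vector `v`. -/
def separableKernels (n : Type*) : AddSubmonoid (n → n → n → n → ℂ) :=
  AddSubmonoid.closure {κ | ∃ v w : n → ℂ, κ = pureKernel v w}

theorem pureKernel_mem {n : Type*} (v w : n → ℂ) : pureKernel v w ∈ separableKernels n :=
  AddSubmonoid.subset_closure ⟨v, w, rfl⟩

theorem smul_mem_separableKernels {n : Type*} {κ : n → n → n → n → ℂ}
    (hκ : κ ∈ separableKernels n) {r : ℝ} (hr : 0 ≤ r) : r • κ ∈ separableKernels n := by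
  induction hκ using AddSubmonoid.closure_induction with
  | mem κ h =>
    obtain ⟨v, w, rfl⟩ := h
    convert pureKernel_mem (fun x => (Real.sqrt r : ℂ) * v x) w using 1
    funext x y p q
    have h2 : (r : ℂ) = (Real.sqrt r : ℂ) * (Real.sqrt r : ℂ) := by
      rw [← Complex.ofReal_mul, Real.mul_self_sqrt hr]
    simp only [Pi.smul_apply, Complex.real_smul, pureKernel, star_mul', RCLike.star_def,
      Complex.conj_ofReal]
    rw [h2]
    ring
  | zero => simp
  | add κ κ' _ _ h h' => rw [smul_add]; exact add_mem h h'

/-- Tensor products of separable kernels are separable. -/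
theorem mul_mem_separableKernels {m n : Type*} {κ : m → m → m → m → ℂ} {μ : n → n → n → n → ℂ}
    (hκ : κ ∈ separableKernels m) (hμ : μ ∈ separableKernels n) :
    (fun x y p q : m × n => κ x.1 y.1 p.1 q.1 * μ x.2 y.2 p.2 q.2) ∈ separableKernels (m × n) := by
  induction hκ using AddSubmonoid.closure_induction with
  | mem κ h =>
    obtain ⟨v, w, rfl⟩ := h
    induction hμ using AddSubmonoid.closure_induction with
    | mem μ h =>
      obtain ⟨v', w', rfl⟩ := h
      convert pureKernel_mem (fun x : m × n => v x.1 * v' x.2)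
        (fun x : m × n => w x.1 * w' x.2) using 1
      funext x y p q
      simp only [pureKernel, star_mul']
      ring
    | zero => simp only [Pi.zero_apply, mul_zero]; exact zero_mem _
    | add μ μ' _ _ h h' => simp only [Pi.add_apply, mul_add]; exact add_mem h h'
  | zero => simp only [Pi.zero_apply, zero_mul]; exact zero_mem _
  | add μ μ' _ _ h h' => simp only [Pi.add_apply, add_mul]; exact add_mem h h'

theorem apply_eq_sum_choiKernel {n : Type*} [Fintype n] [DecidableEq n]
    (L : Matrix n n ℂ →ₗ[ℂ] Matrix n n ℂ) (X : Matrix n n ℂ) (x y : n) :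
    L X x y = ∑ p, ∑ q, choiKernel L x y p q * X p q := by
  conv_lhs => rw [Matrix.matrix_eq_sum_single X]
  simp only [map_sum, Matrix.sum_apply]
  refine Finset.sum_congr rfl fun p _ => Finset.sum_congr rfl fun q _ => ?_
  have : Matrix.single p q (X p q) = X p q • Matrix.single p q (1 : ℂ) := by
    rw [Matrix.smul_single, smul_eq_mul, mul_one]
  rw [this, map_smul, Matrix.smul_apply, smul_eq_mul, mul_comm, choiKernel]

theorem IsSeparableMatrix.zero {m n : Type*} : IsSeparableMatrix (0 : Matrix (m × n) (m × n) ℂ) :=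
  ⟨0, fun _ => 0, fun _ => 0, fun i => i.elim0, fun i => i.elim0, by simp⟩

theorem IsSeparableMatrix.add {m n : Type*} {ρ σ : Matrix (m × n) (m × n) ℂ}
    (hρ : IsSeparableMatrix ρ) (hσ : IsSeparableMatrix σ) : IsSeparableMatrix (ρ + σ) := by
  obtain ⟨r, P, Q, hP, hQ, rfl⟩ := hρ
  obtain ⟨s, P', Q', hP', hQ', rfl⟩ := hσ
  refine ⟨r + s, Fin.append P P', Fin.append Q Q', fun i => ?_, fun i => ?_, ?_⟩
  · refine Fin.addCases (fun j => ?_) (fun j => ?_) i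
    · simpa using hP j
    · simpa using hP' j
  · refine Fin.addCases (fun j => ?_) (fun j => ?_) i
    · simpa using hQ j
    · simpa using hQ' j
  · simp [Fin.sum_univ_add]

theorem IsSeparableMatrix.posSemidef {m n : Type*} [Finite m] [Finite n]
    {ρ : Matrix (m × n) (m × n) ℂ} (hρ : IsSeparableMatrix ρ) : ρ.PosSemidef := by
  obtain ⟨r, P, Q, hP, hQ, rfl⟩ := hρ
  exact Matrix.posSemidef_sum _ fun i _ => (hP i).kronecker (hQ i)

/-- Measuring one tensor factor of a positive semidefinite matrix in the vector `w` leaves a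
positive semidefinite matrix on the other factor. -/
theorem posSemidef_contract {n k : Type*} [Fintype n] [Fintype k]
    {ρ : Matrix (n × k) (n × k) ℂ} (hρ : ρ.PosSemidef) (w : n → ℂ) :
    (Matrix.of fun s t => ∑ p, ∑ q, star (w p) * w q * ρ (p, s) (q, t)).PosSemidef := by
  classical
  convert hρ.conjTranspose_mul_mul_same
    (Matrix.of fun (x : n × k) (s : k) => if x.2 = s then w x.1 else 0) using 1
  ext s t
  simp only [Matrix.mul_apply, Matrix.conjTranspose_apply, Matrix.of_apply, Fintype.sum_prod_type,
    Finset.sum_mul]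
  simp only [apply_ite star, star_zero, ite_mul, zero_mul, mul_ite, mul_zero, Finset.sum_ite_eq',
    Finset.sum_ite_irrel, Finset.sum_const_zero, Finset.mem_univ, if_true]
  rw [Finset.sum_comm]
  refine Finset.sum_congr rfl fun p _ => Finset.sum_congr rfl fun q _ => ?_
  ring

theorem isSeparableMatrix_of_mem_separableKernels {n : Type*} [Fintype n]
    {κ : n → n → n → n → ℂ} (hκ : κ ∈ separableKernels n) {k : ℕ}
    {ρ : Matrix (n × Fin k) (n × Fin k) ℂ} (hρ : ρ.PosSemidef) :
    IsSeparableMatrix (Matrix.of fun x y : n × Fin k =>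
      ∑ p, ∑ q, κ x.1 y.1 p q * ρ (p, x.2) (q, y.2)) := by
  induction hκ using AddSubmonoid.closure_induction with
  | mem κ h =>
    obtain ⟨v, w, rfl⟩ := h
    refine ⟨1, fun _ => Matrix.vecMulVec v (star v), fun _ => Matrix.of fun s t =>
      ∑ p, ∑ q, star (w p) * w q * ρ (p, s) (q, t), fun _ => Matrix.posSemidef_vecMulVec_self_star v,
      fun _ => posSemidef_contract hρ w, ?_⟩
    ext x y
    simp [pureKernel, Matrix.vecMulVec_apply, Finset.mul_sum, mul_assoc]
  | zero =>
    convert IsSeparableMatrix.zero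
    ext x y
    simp
  | add κ κ' _ _ h h' =>
    convert h.add h'
    ext x y
    simp [add_mul, Finset.sum_add_distrib]

theorem mul_mem_separableKernels_of_posSemidef {n : Type*} [Fintype n]
    {P Q : Matrix n n ℂ} (hP : P.PosSemidef) (hQ : Q.PosSemidef) :
    (fun x y p q => P x y * Q p q) ∈ separableKernels n := by
  obtain ⟨k, v, rfl⟩ := Matrix.posSemidef_iff_eq_sum_vecMulVec.mp hP
  obtain ⟨l, w, rfl⟩ := Matrix.posSemidef_iff_eq_sum_vecMulVec.mp hQ
  have : (fun x y p q => (∑ i, Matrix.vecMulVec (v i) (star (v i))) x y *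
      (∑ j, Matrix.vecMulVec (w j) (star (w j))) p q) =
      ∑ i, ∑ j, pureKernel (v i) (star (w j)) := by
    funext x y p q
    simp [Matrix.sum_apply, Matrix.vecMulVec_apply, pureKernel, Finset.sum_mul_sum,
      Finset.sum_apply]
  rw [this]
  exact sum_mem fun k _ => sum_mem fun l _ => pureKernel_mem _ _

/-- A map is entanglement-breaking exactly when its kernel is a sum of pure measure-and-prepare
kernels. One direction tests the map on the unnormalized maximally entangled state. -/
theorem isEntanglementBreaking_iff {n : Type*} [Fintype n] [DecidableEq n]
    (L : Matrix n n ℂ →ₗ[ℂ] Matrix n n ℂ) :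
    IsEntanglementBreaking L ↔ choiKernel L ∈ separableKernels n := by
  constructor
  · rintro ⟨-, h⟩
    let e := Fintype.equivFin n
    let f : n × Fin (Fintype.card n) → ℂ := fun x => if x.2 = e x.1 then 1 else 0
    obtain ⟨r, P, Q, hP, hQ, hρ⟩ := h _ _ (Matrix.posSemidef_vecMulVec_self_star f)
    have key : choiKernel L = ∑ i, fun x y p q => P i x y * (Q i).submatrix e e p q := by
      funext x y p q
      have h2 := congrFun (congrFun hρ (x, e p)) (y, e q)
      simp only [Matrix.sum_apply, Matrix.kronecker_apply] at h2
      simp only [Finset.sum_apply, Matrix.submatrix_apply]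
      rw [← h2, choiKernel, ampliate, Matrix.of_apply]
      refine congrArg (fun X => L X x y) ?_
      ext a b
      simp only [Matrix.single_apply, Matrix.of_apply, Matrix.vecMulVec_apply, f, Pi.star_apply,
        EmbeddingLike.apply_eq_iff_eq]
      split_ifs <;> simp_all
    rw [key]
    exact sum_mem fun i _ => mul_mem_separableKernels_of_posSemidef (hP i) ((hQ i).submatrix e)
  · intro h
    have h2 : ∀ (k : ℕ) (ρ : Matrix (n × Fin k) (n × Fin k) ℂ),
        ρ.PosSemidef → IsSeparableMatrix (ampliate L k ρ) := by
      intro k ρ hρ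
      convert isSeparableMatrix_of_mem_separableKernels h hρ using 1
      ext x y
      simp only [ampliate, Matrix.of_apply, apply_eq_sum_choiKernel]
    exact ⟨fun k ρ hρ => (h2 k ρ hρ).posSemidef, h2⟩

/-- The kernel `A₁B₁ + α A₁B₂ + β A₂B₁ + γ A₂B₂` of `Φ[α, β, γ]`, where an index `1` stands for the
kernel of `X ↦ (Tr X) 1` and an index `2` for the kernel of the identity map on the factor. -/
def depolarizingKernel (m n : Type*) [DecidableEq m] [DecidableEq n] (α β γ : ℝ) :
    m × n → m × n → m × n → m × n → ℂ := fun x y p q =>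
  (if x.1 = y.1 ∧ p.1 = q.1 then 1 else 0) * (if x.2 = y.2 ∧ p.2 = q.2 then 1 else 0)
    + α * ((if x.1 = y.1 ∧ p.1 = q.1 then 1 else 0) * (if x.2 = p.2 ∧ y.2 = q.2 then 1 else 0))
    + β * ((if x.1 = p.1 ∧ y.1 = q.1 then 1 else 0) * (if x.2 = y.2 ∧ p.2 = q.2 then 1 else 0))
    + γ * ((if x.1 = p.1 ∧ y.1 = q.1 then 1 else 0) * (if x.2 = p.2 ∧ y.2 = q.2 then 1 else 0))

theorem choiKernel_bipartiteDepolarizing (dA dB : ℕ) (α β γ : ℝ) :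
    choiKernel (bipartiteDepolarizing dA dB α β γ) =
      depolarizingKernel (Fin dA) (Fin dB) α β γ := by
  funext ⟨a, b⟩ ⟨a', b'⟩ ⟨c, d⟩ ⟨c', d'⟩
  have h1 : (Matrix.single (c, d) (c', d') (1 : ℂ)).trace =
      (if c = c' then 1 else 0) * (if d = d' then 1 else 0) := by
    by_cases h : (c, d) = (c', d')
    · obtain ⟨rfl, rfl⟩ := Prod.mk.inj h
      simp
    · rw [Matrix.trace_single_eq_of_ne _ _ _ h]
      by_cases h2 : c = c' <;> by_cases h3 : d = d' <;> simp_all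
  have h2 : partialTraceLeft (Matrix.single (c, d) (c', d') (1 : ℂ)) b b' =
      (if c = c' then 1 else 0) * (if b = d ∧ b' = d' then 1 else 0) := by
    simp only [partialTraceLeft, LinearMap.coe_mk, AddHom.coe_mk, Matrix.of_apply,
      Matrix.single_apply, Prod.mk.injEq]
    by_cases h : c = c'
    · subst h
      rw [Finset.sum_eq_single c] <;> simp +contextual [eq_comm]
    · rw [Finset.sum_eq_zero]
      · simp [h]
      · rintro x -
        rw [if_neg]
        rintro ⟨⟨rfl, -⟩, ⟨rfl, -⟩⟩
        exact h rfl
  have h3 : partialTraceRight (Matrix.single (c, d) (c', d') (1 : ℂ)) a a' =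
      (if d = d' then 1 else 0) * (if a = c ∧ a' = c' then 1 else 0) := by
    simp only [partialTraceRight, LinearMap.coe_mk, AddHom.coe_mk, Matrix.of_apply,
      Matrix.single_apply, Prod.mk.injEq]
    by_cases h : d = d'
    · subst h
      rw [Finset.sum_eq_single d] <;> simp +contextual [eq_comm]
    · rw [Finset.sum_eq_zero]
      · simp [h]
      · rintro x -
        rw [if_neg]
        rintro ⟨⟨-, rfl⟩, ⟨-, rfl⟩⟩
        exact h rfl
  have h4 : Matrix.single (c, d) (c', d') (1 : ℂ) (a, b) (a', b') =
      (if a = c ∧ a' = c' then 1 else 0) * (if b = d ∧ b' = d' then 1 else 0) := by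
    simp only [Matrix.single_apply, Prod.mk.injEq]
    by_cases h5 : a = c <;> by_cases h6 : a' = c' <;> simp [h5, h6, eq_comm]
  simp only [choiKernel, bipartiteDepolarizing, LinearMap.coe_mk, AddHom.coe_mk, Matrix.add_apply,
    Matrix.smul_apply, Matrix.kronecker_apply, h1, h2, h3, h4, Matrix.one_apply, smul_eq_mul,
    depolarizingKernel, Prod.mk.injEq, ite_and]
  by_cases ha : a = a' <;> by_cases hb : b = b' <;> by_cases hc : c = c' <;>
    by_cases hd : d = d' <;> simp [ha, hb, hc, hd]

/-! ### Witnesses for the six inequalities -/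

/-- The pairing of a kernel with the operator `t 1 + r Ω_A + s Ω_B + u Ω_A Ω_B`, where `Ω_A` and
`Ω_B` are the unnormalized projections onto the maximally entangled vectors of the two factors. -/
def witness {m n : Type*} [Fintype m] [Fintype n] (t r s u : ℂ)
    (κ : m × n → m × n → m × n → m × n → ℂ) : ℂ :=
  ∑ a, ∑ b, ∑ c, ∑ d, (t * κ (a, b) (a, b) (c, d) (c, d) + r * κ (a, b) (c, b) (a, d) (c, d)
    + s * κ (a, b) (a, d) (c, b) (c, d) + u * κ (a, b) (c, d) (a, b) (c, d))

/-- An operator that is nonnegative on product vectors is nonnegative on separable kernels. -/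
theorem witness_nonneg {m n : Type*} [Fintype m] [Fintype n] {t r s u : ℂ}
    (h : ∀ v w : m × n → ℂ, 0 ≤ witness t r s u (pureKernel v w))
    {κ : m × n → m × n → m × n → m × n → ℂ} (hκ : κ ∈ separableKernels (m × n)) :
    0 ≤ witness t r s u κ := by
  induction hκ using AddSubmonoid.closure_induction with
  | mem κ hκ =>
    obtain ⟨v, w, rfl⟩ := hκ
    exact h v w
  | zero => simp [witness]
  | add κ μ _ _ h h' =>
    have : witness t r s u (κ + μ) = witness t r s u κ + witness t r s u μ := by
      simp only [witness, ← Finset.sum_add_distrib, Pi.add_apply]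
      refine Finset.sum_congr rfl fun a _ => Finset.sum_congr rfl fun b _ =>
        Finset.sum_congr rfl fun c _ => Finset.sum_congr rfl fun d _ => ?_
      ring
    rw [this]
    exact add_nonneg h h'

theorem witness_depolarizingKernel (m n : ℕ) (α β γ : ℝ) (t r s u : ℂ) :
    witness t r s u (depolarizingKernel (Fin m) (Fin n) α β γ) =
      t * ((m * n) ^ 2 + α * (m ^ 2 * n) + β * (m * n ^ 2) + γ * (m * n))
      + r * (m * n ^ 2 + α * (m * n) + β * (m * n) ^ 2 + γ * (m ^ 2 * n))
      + s * (m ^ 2 * n + α * (m * n) ^ 2 + β * (m * n) + γ * (m * n ^ 2))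
      + u * (m * n + α * (m * n ^ 2) + β * (m ^ 2 * n) + γ * (m * n) ^ 2) := by
  simp only [witness, depolarizingKernel, mul_add, Finset.sum_add_distrib]
  simp
  ring

/-- The pairing with `(1 ± F_A)(1 ± F_B)` after partial transposition. -/
theorem witness_swap_nonneg {m n : Type*} [Fintype m] [Fintype n] (v w : m × n → ℂ) {r s : ℝ}
    (hr : r * r = 1) (hs : s * s = 1) : 0 ≤ witness 1 r s (r * s) (pureKernel v w) := by
  have hr' : (r : ℂ) * r = 1 := by exact_mod_cast hr
  have hs' : (s : ℂ) * s = 1 := by exact_mod_cast hs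
  let f : m → n → m → n → ℂ := fun a b c d => v (a, b) * w (c, d)
  let g : m → n → m → n → ℂ := fun a b c d =>
    f a b c d + r * f c b a d + s * f a d c b + r * s * f c d a b
  have e0 : witness 1 r s (r * s) (pureKernel v w) =
      ∑ a, ∑ b, ∑ c, ∑ d, f a b c d * star (g a b c d) := by
    refine Finset.sum_congr rfl fun a _ => Finset.sum_congr rfl fun b _ =>
        Finset.sum_congr rfl fun c _ => Finset.sum_congr rfl fun d _ => ?_
    simp only [pureKernel, f, g, star_add, star_mul', RCLike.star_def, Complex.conj_ofReal]
    ring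
  -- `g` is an eigenvector of both swaps, so each of its four summands contributes the same amount.
  have swapA : ∀ h : m → n → m → n → ℂ,
      ∑ a, ∑ b, ∑ c, ∑ d, h a b c d = ∑ a, ∑ b, ∑ c, ∑ d, h c b a d := by
    intro h
    rw [Finset.sum_comm]
    conv_rhs => rw [Finset.sum_comm]
    exact Finset.sum_congr rfl fun b _ => Finset.sum_comm
  have swapB : ∀ h : m → n → m → n → ℂ,
      ∑ a, ∑ b, ∑ c, ∑ d, h a b c d = ∑ a, ∑ b, ∑ c, ∑ d, h a d c b := by
    intro h
    refine Finset.sum_congr rfl fun a _ => ?_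
    rw [Finset.sum_comm]
    conv_rhs => rw [Finset.sum_comm]
    exact Finset.sum_congr rfl fun b _ => Finset.sum_comm
  have gA : ∀ a b c d, g c b a d = r * g a b c d := by
    intro a b c d
    simp only [g]
    linear_combination (-f c b a d - s * f c d a b) * hr'
  have gB : ∀ a b c d, g a d c b = s * g a b c d := by
    intro a b c d
    simp only [g]
    linear_combination (-f a d c b - r * f c d a b) * hs'
  have stepA : ∀ h : m → n → m → n → ℂ, ∑ a, ∑ b, ∑ c, ∑ d, r * h c b a d * star (g a b c d) =
      ∑ a, ∑ b, ∑ c, ∑ d, h a b c d * star (g a b c d) := by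
    intro h
    rw [swapA]
    refine Finset.sum_congr rfl fun a _ => Finset.sum_congr rfl fun b _ =>
        Finset.sum_congr rfl fun c _ => Finset.sum_congr rfl fun d _ => ?_
    rw [gA a b c d, star_mul', RCLike.star_def, Complex.conj_ofReal]
    linear_combination (h a b c d * (starRingEnd ℂ) (g a b c d)) * hr'
  have stepB : ∀ h : m → n → m → n → ℂ, ∑ a, ∑ b, ∑ c, ∑ d, s * h a d c b * star (g a b c d) =
      ∑ a, ∑ b, ∑ c, ∑ d, h a b c d * star (g a b c d) := by
    intro h
    rw [swapB]
    refine Finset.sum_congr rfl fun a _ => Finset.sum_congr rfl fun b _ =>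
        Finset.sum_congr rfl fun c _ => Finset.sum_congr rfl fun d _ => ?_
    rw [gB a b c d, star_mul', RCLike.star_def, Complex.conj_ofReal]
    linear_combination (h a b c d * (starRingEnd ℂ) (g a b c d)) * hs'
  have e1 : ∑ a, ∑ b, ∑ c, ∑ d, g a b c d * star (g a b c d) =
      4 * ∑ a, ∑ b, ∑ c, ∑ d, f a b c d * star (g a b c d) := by
    have : ∑ a, ∑ b, ∑ c, ∑ d, g a b c d * star (g a b c d) =
        (∑ a, ∑ b, ∑ c, ∑ d, f a b c d * star (g a b c d))
        + (∑ a, ∑ b, ∑ c, ∑ d, r * f c b a d * star (g a b c d))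
        + (∑ a, ∑ b, ∑ c, ∑ d, s * f a d c b * star (g a b c d))
        + ∑ a, ∑ b, ∑ c, ∑ d, r * (s * f c d a b) * star (g a b c d) := by
      simp only [← Finset.sum_add_distrib]
      refine Finset.sum_congr rfl fun a _ => Finset.sum_congr rfl fun b _ =>
        Finset.sum_congr rfl fun c _ => Finset.sum_congr rfl fun d _ => ?_
      simp only [g]
      ring
    rw [this, stepA f, stepB f, stepA (fun a b c d => s * f a d c b), stepB f]
    ring
  have e2 : 0 ≤ ∑ a, ∑ b, ∑ c, ∑ d, g a b c d * star (g a b c d) :=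
    Finset.sum_nonneg fun a _ => Finset.sum_nonneg fun b _ => Finset.sum_nonneg fun c _ =>
      Finset.sum_nonneg fun d _ => mul_star_self_nonneg _
  rw [e1] at e2
  rw [e0]
  have h4 : (0 : ℂ) ≤ ((1 / 4 : ℝ) : ℂ) := Complex.zero_le_real.mpr (by norm_num)
  convert mul_nonneg h4 e2 using 1
  push_cast
  ring

/-- The pairing with `Ω_A Ω_B` is the squared overlap `|⟨w, v⟩|²`. -/
theorem sum_pureKernel_diag {m n : Type*} [Fintype m] [Fintype n] (v w : m × n → ℂ) :
    ∑ a, ∑ b, ∑ c, ∑ d, pureKernel v w (a, b) (c, d) (a, b) (c, d) =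
      (∑ a, ∑ b, v (a, b) * star (w (a, b))) * star (∑ a, ∑ b, v (a, b) * star (w (a, b))) := by
  simp only [Finset.sum_mul]
  simp only [star_sum, star_mul', star_star, Finset.mul_sum, pureKernel]
  refine Finset.sum_congr rfl fun a _ => Finset.sum_congr rfl fun b _ =>
        Finset.sum_congr rfl fun c _ => Finset.sum_congr rfl fun d _ => ?_
  ring

theorem norm_sum_sq_le {m : Type*} [Fintype m] (f : m → ℂ) :
    ‖∑ a, f a‖ ^ 2 ≤ Fintype.card m * ∑ a, ‖f a‖ ^ 2 := by
  calc ‖∑ a, f a‖ ^ 2 ≤ (∑ a, ‖f a‖) ^ 2 := by gcongr; exact norm_sum_le _ _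
    _ ≤ _ := by simpa using sq_sum_le_card_mul_sum_sq (s := Finset.univ) (f := fun a => ‖f a‖)

/-- Cauchy–Schwarz for the Frobenius norm: an `m × m` matrix satisfies `|tr X|² ≤ m ‖X‖²`. -/
theorem witness_card_nonneg {m n : Type*} [Fintype m] [Fintype n] (v w : m × n → ℂ) :
    0 ≤ witness 0 0 (Fintype.card m) (-1) (pureKernel v w) := by
  have e : witness 0 0 (Fintype.card m) (-1) (pureKernel v w) =
      ((Fintype.card m * ∑ a, ∑ c, ‖∑ b, v (a, b) * star (w (c, b))‖ ^ 2
        - ‖∑ a, ∑ b, v (a, b) * star (w (a, b))‖ ^ 2 : ℝ) : ℂ) := by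
    have h1 : ∑ a, ∑ b, ∑ c, ∑ d, pureKernel v w (a, b) (a, d) (c, b) (c, d) =
        ∑ a, ∑ c, (((‖∑ b, v (a, b) * star (w (c, b))‖ ^ 2 : ℝ)) : ℂ) := by
      refine Finset.sum_congr rfl fun a _ => ?_
      rw [Finset.sum_comm]
      refine Finset.sum_congr rfl fun c _ => ?_
      rw [Complex.ofReal_pow, ← Complex.mul_conj', ← RCLike.star_def]
      simp only [Finset.sum_mul]
      simp only [star_sum, star_mul', star_star, Finset.mul_sum, pureKernel]
      refine Finset.sum_congr rfl fun b _ => Finset.sum_congr rfl fun d _ => ?_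
      ring
    have h2 := sum_pureKernel_diag v w
    rw [RCLike.star_def, Complex.mul_conj'] at h2
    simp only [witness, zero_mul, zero_add, Finset.sum_add_distrib, ← Finset.mul_sum, h1, h2]
    push_cast
    simp only [RCLike.star_def]
    ring
  rw [e, Complex.zero_le_real, sub_nonneg]
  refine (norm_sum_sq_le _).trans ?_
  gcongr with a
  exact Finset.single_le_sum (f := fun c => ‖∑ b, v (a, b) * star (w (c, b))‖ ^ 2)
    (fun _ _ => by positivity) (Finset.mem_univ a)

/-- A matrix `Wᴴ V` that factors through `m` dimensions satisfies `|tr Wᴴ V|² ≤ m ‖Wᴴ V‖²`,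
whatever its size. -/
theorem norm_trace_sq_le {m n : Type*} [Fintype m] [Fintype n] (V W : Matrix m n ℂ) :
    ‖(W.conjTranspose * V).trace‖ ^ 2 ≤
      Fintype.card m * ∑ d, ∑ b, ‖(W.conjTranspose * V) d b‖ ^ 2 := by
  classical
  -- A common unitary change of basis makes the rows of `W` orthogonal.
  obtain ⟨V', W', D, hK, hW⟩ : ∃ (V' W' : Matrix m n ℂ) (D : m → ℂ),
      W.conjTranspose * V = W'.conjTranspose * V' ∧ W' * W'.conjTranspose = Matrix.diagonal D := by
    have hG : (W * W.conjTranspose).IsHermitian := Matrix.isHermitian_mul_conjTranspose_self W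
    let U : Matrix m m ℂ := hG.eigenvectorUnitary
    have hU : U * star U = 1 := Unitary.mul_star_self_of_mem hG.eigenvectorUnitary.2
    have hU' : star U * U = 1 := Unitary.star_mul_self_of_mem hG.eigenvectorUnitary.2
    refine ⟨star U * V, star U * W, fun i => (hG.eigenvalues i : ℂ), ?_, ?_⟩
    · rw [Matrix.conjTranspose_mul, Matrix.star_eq_conjTranspose, Matrix.conjTranspose_conjTranspose,
        Matrix.mul_assoc, ← Matrix.mul_assoc U, ← Matrix.star_eq_conjTranspose, hU, Matrix.one_mul]
    · have h := hG.spectral_theorem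
      rw [Unitary.conjStarAlgAut_apply] at h
      calc star U * W * (star U * W).conjTranspose = star U * (W * W.conjTranspose) * U := by
            simp only [Matrix.star_eq_conjTranspose, Matrix.conjTranspose_mul,
              Matrix.conjTranspose_conjTranspose, Matrix.mul_assoc]
        _ = star U * (U * Matrix.diagonal (RCLike.ofReal ∘ hG.eigenvalues) * star U) * U :=
            congrArg (fun X => star U * X * U) h
        _ = (star U * U) * Matrix.diagonal (RCLike.ofReal ∘ hG.eigenvalues) * (star U * U) := by
            simp only [Matrix.mul_assoc]
        _ = _ := by
            rw [hU', Matrix.one_mul, Matrix.mul_one]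
            rfl
  rw [hK]
  have hrow : ∀ a c, ∑ d, W' a d * star (W' c d) = if a = c then D a else 0 := by
    intro a c
    have := congrFun (congrFun hW a) c
    simpa [Matrix.mul_apply, Matrix.diagonal_apply] using this
  have htr : (W'.conjTranspose * V').trace = ∑ a, ∑ b, star (W' a b) * V' a b := by
    simp only [Matrix.trace, Matrix.diag_apply, Matrix.mul_apply, Matrix.conjTranspose_apply]
    exact Finset.sum_comm
  have hfro : ∑ d, ∑ b, ‖(W'.conjTranspose * V') d b‖ ^ 2 =
      ∑ a, (∑ b, ‖W' a b‖ ^ 2) * ∑ b, ‖V' a b‖ ^ 2 := by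
    have hc : ((∑ d, ∑ b, ‖(W'.conjTranspose * V') d b‖ ^ 2 : ℝ) : ℂ) =
        ((∑ a, (∑ b, ‖W' a b‖ ^ 2) * ∑ b, ‖V' a b‖ ^ 2 : ℝ) : ℂ) := by
      push_cast
      simp only [← Complex.mul_conj', ← RCLike.star_def, Matrix.mul_apply,
        Matrix.conjTranspose_apply]
      have h3 : ∀ d b, (∑ a, star (W' a d) * V' a b) * star (∑ a, star (W' a d) * V' a b) =
          ∑ a, ∑ c, (W' c d * star (W' a d)) * (V' a b * star (V' c b)) := by
        intro d b
        simp only [star_sum, star_mul', star_star, Finset.sum_mul_sum]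
        refine Finset.sum_congr rfl fun a _ => Finset.sum_congr rfl fun c _ => ?_
        ring
      simp only [h3]
      have h4 : ∀ d, ∑ b, ∑ a, ∑ c, (W' c d * star (W' a d)) * (V' a b * star (V' c b)) =
          ∑ a, ∑ c, (W' c d * star (W' a d)) * ∑ b, V' a b * star (V' c b) := by
        intro d
        rw [Finset.sum_comm]
        refine Finset.sum_congr rfl fun a _ => ?_
        rw [Finset.sum_comm]
        simp only [Finset.mul_sum]
      simp only [h4]
      rw [Finset.sum_comm]
      refine Finset.sum_congr rfl fun a _ => ?_
      rw [Finset.sum_comm]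
      simp only [← Finset.sum_mul]
      simp only [hrow]
      simp
    exact_mod_cast hc
  rw [htr, hfro]
  refine (norm_sum_sq_le _).trans ?_
  gcongr with a
  calc ‖∑ b, star (W' a b) * V' a b‖ ^ 2 ≤ (∑ b, ‖W' a b‖ * ‖V' a b‖) ^ 2 := by
        gcongr
        refine (norm_sum_le _ _).trans_eq ?_
        simp
    _ ≤ _ := Finset.sum_mul_sq_le_sq_mul_sq _ _ _

/-- The case of `norm_trace_sq_le` in which `v` and `w` are read as `m × n` matrices: it is the
witness for the last inequality. -/
theorem witness_rank_nonneg {m n : Type*} [Fintype m] [Fintype n] (v w : m × n → ℂ) :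
    0 ≤ witness 0 (Fintype.card m) 0 (-1) (pureKernel v w) := by
  have e : witness 0 (Fintype.card m) 0 (-1) (pureKernel v w) =
      ((Fintype.card m * ∑ d, ∑ b, ‖∑ a, star (w (a, d)) * v (a, b)‖ ^ 2
        - ‖∑ d, ∑ a, star (w (a, d)) * v (a, d)‖ ^ 2 : ℝ) : ℂ) := by
    have h1 : ∑ a, ∑ b, ∑ c, ∑ d, pureKernel v w (a, b) (c, b) (a, d) (c, d) =
        ∑ d, ∑ b, (((‖∑ a, star (w (a, d)) * v (a, b)‖ ^ 2 : ℝ)) : ℂ) := by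
      rw [Finset.sum_comm]
      conv_rhs => rw [Finset.sum_comm]
      refine Finset.sum_congr rfl fun b _ => ?_
      have : ∀ a, ∑ c, ∑ d, pureKernel v w (a, b) (c, b) (a, d) (c, d) =
          ∑ d, ∑ c, pureKernel v w (a, b) (c, b) (a, d) (c, d) := fun a => Finset.sum_comm
      simp only [this]
      rw [Finset.sum_comm]
      refine Finset.sum_congr rfl fun d _ => ?_
      rw [Complex.ofReal_pow, ← Complex.mul_conj', ← RCLike.star_def]
      simp only [star_sum, star_mul', star_star, Finset.sum_mul_sum, pureKernel]
      refine Finset.sum_congr rfl fun b _ => Finset.sum_congr rfl fun d _ => ?_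
      ring
    have h2 := sum_pureKernel_diag v w
    have h3 : ∑ a, ∑ b, v (a, b) * star (w (a, b)) = ∑ d, ∑ a, star (w (a, d)) * v (a, d) := by
      simp only [mul_comm (v _)]
      exact Finset.sum_comm
    rw [h3, RCLike.star_def, Complex.mul_conj'] at h2
    simp only [witness, zero_mul, zero_add, add_zero, Finset.sum_add_distrib, ← Finset.mul_sum, h1]
    rw [h2]
    push_cast
    simp only [RCLike.star_def]
    ring
  rw [e, Complex.zero_le_real, sub_nonneg]
  have := norm_trace_sq_le (Matrix.of fun a b => v (a, b)) (Matrix.of fun a b => w (a, b))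
  simpa [Matrix.trace, Matrix.mul_apply] using this

theorem witness_overlap_nonneg {m n : Type*} [Fintype m] [Fintype n] (v w : m × n → ℂ) :
    0 ≤ witness 0 0 0 1 (pureKernel v w) := by
  simp only [witness, zero_mul, zero_add, one_mul, sum_pureKernel_diag]
  exact mul_star_self_nonneg _

/-- Each inequality is a witness evaluated on the kernel of `Φ[α, β, γ]`. -/
theorem mem_ebSolid_of_separable {m n : ℕ} (hm : 2 ≤ m) (hmn : m ≤ n) {α β γ : ℝ}
    (h : depolarizingKernel (Fin m) (Fin n) α β γ ∈ separableKernels (Fin m × Fin n)) :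
    ![α, β, γ] ∈ ebSolid m n := by
  have hm' : (2 : ℝ) ≤ m := by exact_mod_cast hm
  have hmn' : (m : ℝ) ≤ n := by exact_mod_cast hmn
  have hn0 : (0 : ℝ) < n := by linarith
  have hpos : (0 : ℝ) < m * n := by positivity
  -- The value of a witness on `Φ[α, β, γ]`, as an inequality between real numbers.
  have key : ∀ t r s u : ℝ,
      (∀ v w : Fin m × Fin n → ℂ, 0 ≤ witness (t : ℂ) r s u (pureKernel v w)) →
      0 ≤ t * ((m * n) ^ 2 + α * (m ^ 2 * n) + β * (m * n ^ 2) + γ * (m * n))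
      + r * (m * n ^ 2 + α * (m * n) + β * (m * n) ^ 2 + γ * (m ^ 2 * n))
      + s * (m ^ 2 * n + α * (m * n) ^ 2 + β * (m * n) + γ * (m * n ^ 2))
      + u * (m * n + α * (m * n ^ 2) + β * (m ^ 2 * n) + γ * (m * n) ^ 2) := by
    intro t r s u hw
    have := witness_nonneg hw h
    rw [witness_depolarizingKernel] at this
    exact_mod_cast this
  have k1 := key 0 0 m (-1) fun v w => by simpa using witness_card_nonneg v w
  have k2 := key 0 0 0 1 fun v w => by simpa using witness_overlap_nonneg v w
  have k3 := key 1 1 (-1) (1 * -1) fun v w => by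
    simpa using witness_swap_nonneg v w (r := 1) (s := -1) (by norm_num) (by norm_num)
  have k4 := key 1 (-1) 1 (-1 * 1) fun v w => by
    simpa using witness_swap_nonneg v w (r := -1) (s := 1) (by norm_num) (by norm_num)
  have k5 := key 1 (-1) (-1) (-1 * -1) fun v w => by
    simpa using witness_swap_nonneg v w (r := -1) (s := -1) (by norm_num) (by norm_num)
  have k6 := key 0 m 0 (-1) fun v w => by simpa using witness_rank_nonneg v w
  refine ⟨?_, ?_, ?_, ?_, ?_, ?_⟩
  all_goals simp only [Matrix.cons_val_zero, Matrix.cons_val_one, Matrix.cons_val]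
  · have : 0 ≤ (m * n * (m ^ 2 - 1)) * (1 + n * α) := by linarith
    have h1 : (0 : ℝ) < m * n * (m ^ 2 - 1) := mul_pos hpos (by nlinarith)
    have h2 := (mul_nonneg_iff_of_pos_left h1).mp this
    rw [neg_le_iff_add_nonneg', ← sub_nonneg]
    have : 1 / (n : ℝ) + α = (1 + n * α) / n := by field_simp
    rw [sub_zero, this]
    positivity
  · exact (mul_nonneg_iff_of_pos_left hpos).mp (by linarith)
  · exact (mul_nonneg_iff_of_pos_left (b := 1 - α + β - γ)
      (show (0 : ℝ) < m * n * ((m + 1) * (n - 1)) by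
        exact mul_pos hpos (mul_pos (by linarith) (by linarith)))).mp (by linarith)
  · exact (mul_nonneg_iff_of_pos_left (b := 1 + α - β - γ)
      (show (0 : ℝ) < m * n * ((m - 1) * (n + 1)) by
        exact mul_pos hpos (mul_pos (by linarith) (by linarith)))).mp (by linarith)
  · exact (mul_nonneg_iff_of_pos_left (b := 1 - α - β + γ)
      (show (0 : ℝ) < m * n * ((m - 1) * (n - 1)) by
        exact mul_pos hpos (mul_pos (by linarith) (by linarith)))).mp (by linarith)
  · exact (mul_nonneg_iff_of_pos_left hpos).mp (by linarith)

/-! ### Explicit decompositions of the vertices -/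

theorem two_pow_add_two_pow_eq {a b c d : ℕ} (h : 2 ^ a + 2 ^ b = 2 ^ c + 2 ^ d) :
    (a = c ∧ b = d) ∨ (a = d ∧ b = c) := by
  have key : ∀ {a b c d : ℕ}, a ≤ b → c ≤ d → 2 ^ a + 2 ^ b = 2 ^ c + 2 ^ d → a = c ∧ b = d := by
    intro a b c d hab hcd h
    have hlt : ∀ {a b c d : ℕ}, a ≤ b → b < d → 2 ^ a + 2 ^ b < 2 ^ c + 2 ^ d := by
      intro a b c d hab hbd
      have h1 : 2 ^ a ≤ 2 ^ b := Nat.pow_le_pow_right (by norm_num) hab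
      have h2 : 2 ^ (b + 1) ≤ 2 ^ d := Nat.pow_le_pow_right (by norm_num) hbd
      have h3 : 0 < 2 ^ c := by positivity
      rw [pow_succ] at h2
      omega
    rcases lt_trichotomy b d with h1 | rfl | h1
    · exact absurd h (hlt hab h1).ne
    · exact ⟨Nat.pow_right_injective le_rfl (by simpa using h), rfl⟩
    · exact absurd h (hlt hcd h1).ne'
  rcases le_total a b with h1 | h1 <;> rcases le_total c d with h2 | h2
  · exact Or.inl (key h1 h2 h)
  · exact Or.inr (key h1 h2 (by omega))
  · exact Or.inr ((key h1 h2 (by omega)).symm)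
  · exact Or.inl ((key h1 h2 (by omega)).symm)

theorem star_stdAddChar {N : ℕ} [NeZero N] (k : ZMod N) :
    star (ZMod.stdAddChar k) = ZMod.stdAddChar (-k) := by
  rw [AddChar.map_neg_eq_conj, RCLike.star_def]

theorem sum_stdAddChar_mul {N : ℕ} [NeZero N] (k : ZMod N) :
    ∑ t : ZMod N, ZMod.stdAddChar (t * k) = if k = 0 then (N : ℂ) else 0 := by
  rw [AddChar.sum_mulShift k (ZMod.isPrimitive_stdAddChar N), ZMod.card]
  split_ifs <;> simp

/-- A finite family of phase vectors that averages like independent uniform phases in fourth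
moments. The frequencies `2 ^ x` form a Sidon set, so only the trivial resonances survive. -/
theorem exists_phases (d : ℕ) : ∃ (N : ℕ) (_ : NeZero N) (z : ZMod N → Fin d → ℂ),
    ∀ x y p q, ∑ t, z t x * star (z t y) * (star (z t p) * z t q) =
      if (x = y ∧ p = q) ∨ (x = p ∧ y = q) then (N : ℂ) else 0 := by
  refine ⟨2 ^ (d + 1), inferInstance,
    fun t x => ZMod.stdAddChar (t * ((2 ^ (x : ℕ) : ℕ) : ZMod (2 ^ (d + 1)))), ?_⟩
  intro x y p q
  have h1 : ∀ t : ZMod (2 ^ (d + 1)),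
      ZMod.stdAddChar (t * ((2 ^ (x : ℕ) : ℕ) : ZMod (2 ^ (d + 1)))) *
      star (ZMod.stdAddChar (t * ((2 ^ (y : ℕ) : ℕ) : ZMod (2 ^ (d + 1))))) *
      (star (ZMod.stdAddChar (t * ((2 ^ (p : ℕ) : ℕ) : ZMod (2 ^ (d + 1))))) *
        ZMod.stdAddChar (t * ((2 ^ (q : ℕ) : ℕ) : ZMod (2 ^ (d + 1))))) =
      ZMod.stdAddChar (t * (((2 ^ (x : ℕ) + 2 ^ (q : ℕ) : ℕ) : ZMod (2 ^ (d + 1))) -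
        ((2 ^ (y : ℕ) + 2 ^ (p : ℕ) : ℕ) : ZMod (2 ^ (d + 1))))) := by
    intro t
    rw [star_stdAddChar, star_stdAddChar, ← AddChar.map_add_eq_mul, ← AddChar.map_add_eq_mul,
      ← AddChar.map_add_eq_mul]
    congr 1
    push_cast
    ring
  simp only [h1]
  rw [sum_stdAddChar_mul]
  have hlt : ∀ x y : Fin d, 2 ^ (x : ℕ) + 2 ^ (y : ℕ) < 2 ^ (d + 1) := by
    intro x y
    have hx : 2 ^ (x : ℕ) < 2 ^ d := Nat.pow_lt_pow_right (by norm_num) x.2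
    have hy : 2 ^ (y : ℕ) < 2 ^ d := Nat.pow_lt_pow_right (by norm_num) y.2
    rw [pow_succ]
    omega
  refine if_congr ?_ rfl rfl
  rw [sub_eq_zero, ZMod.natCast_eq_natCast_iff', Nat.mod_eq_of_lt (hlt _ _),
    Nat.mod_eq_of_lt (hlt _ _)]
  constructor
  · intro h
    rcases two_pow_add_two_pow_eq h with ⟨h1, h2⟩ | ⟨h1, h2⟩
    · exact Or.inl ⟨Fin.ext h1, Fin.ext h2.symm⟩
    · exact Or.inr ⟨Fin.ext h1, Fin.ext h2.symm⟩
  · rintro (⟨rfl, rfl⟩ | ⟨rfl, rfl⟩)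
    · rfl
    · exact add_comm _ _

/-- The map `X ↦ (Tr X) 1 + X` is a sum of pure measure-and-prepare maps. -/
theorem add_mem_separableKernels (d : ℕ) :
    (fun x y p q : Fin d => (if x = y ∧ p = q then (1 : ℂ) else 0)
      + (if x = p ∧ y = q then 1 else 0)) ∈ separableKernels (Fin d) := by
  have h4 : ∀ x y p q, ∑ a : Fin d, pureKernel (Pi.single a (1 : ℂ)) (Pi.single a 1) x y p q =
      if x = y ∧ x = p ∧ x = q then 1 else 0 := by
    intro x y p q
    rw [Finset.sum_eq_single x]
    · simp only [pureKernel, Pi.single_apply]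
      by_cases h1 : x = y <;> by_cases h2 : x = p <;> by_cases h3 : x = q <;>
        simp_all [eq_comm]
    · intro b _ hb
      simp [pureKernel, Pi.single_apply, hb.symm]
    · simp
  obtain ⟨N, _, z, hz⟩ := exists_phases d
  have hN : (N : ℂ) ≠ 0 := by exact_mod_cast NeZero.ne N
  have h1 : (1 / N : ℝ) • ∑ t, pureKernel (z t) (z t) ∈ separableKernels (Fin d) :=
    smul_mem_separableKernels (sum_mem fun t _ => pureKernel_mem _ _) (by positivity)
  have h2 : ∑ a : Fin d, pureKernel (Pi.single a (1 : ℂ)) (Pi.single a 1) ∈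
      separableKernels (Fin d) := sum_mem fun a _ => pureKernel_mem _ _
  convert add_mem h1 h2 using 1
  funext x y p q
  simp only [Pi.add_apply, Pi.smul_apply, Finset.sum_apply, Complex.real_smul]
  have h3 : ∑ t, pureKernel (z t) (z t) x y p q = _ := hz x y p q
  rw [h3, h4]
  clear h3 h4 h1 h2 hz
  push_cast
  rw [mul_ite, mul_zero, one_div_mul_cancel hN]
  by_cases h1 : x = y <;> by_cases h2 : p = q <;> by_cases h3 : x = p <;> by_cases h4 : y = q <;>
    simp_all

/-- The map `X ↦ (Tr X) 1 - X / d` is a sum of pure measure-and-prepare maps, each of which measures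
in a vector orthogonal to the vector that it prepares. -/
theorem sub_mem_separableKernels (d : ℕ) [NeZero d] :
    (fun x y p q : Fin d => (if x = y ∧ p = q then (1 : ℂ) else 0)
      - 1 / d * (if x = p ∧ y = q then 1 else 0)) ∈ separableKernels (Fin d) := by
  have h4 : ∀ x y p q, ∑ a : Fin d, ∑ c ∈ Finset.univ.erase a,
      pureKernel (Pi.single a (1 : ℂ)) (Pi.single c 1) x y p q =
      if x = y ∧ p = q ∧ x ≠ p then 1 else 0 := by
    intro x y p q
    rw [Finset.sum_eq_single x]
    · by_cases h : p = x
      · subst h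
        rw [Finset.sum_eq_zero]
        · simp
        · intro c hc
          simp [pureKernel, Pi.single_apply, (Finset.ne_of_mem_erase hc).symm]
      · rw [Finset.sum_eq_single_of_mem p (by simp [h])]
        · simp only [pureKernel, Pi.single_apply]
          by_cases h1 : x = y <;> by_cases h2 : p = q <;> simp_all [eq_comm]
        · intro c _ hc
          simp [pureKernel, Pi.single_apply, hc.symm]
    · intro b _ hb
      simp [pureKernel, Pi.single_apply, hb.symm]
    · simp
  obtain ⟨N, _, z, hz⟩ := exists_phases d
  have hN : (N : ℂ) ≠ 0 := by exact_mod_cast NeZero.ne N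
  have hd : (d : ℂ) ≠ 0 := by exact_mod_cast NeZero.ne d
  let e : ZMod d → Fin d → ℂ := fun k x => ZMod.stdAddChar (k * ((x : ℕ) : ZMod d))
  have h1 : (1 / (d * N) : ℝ) • ∑ t, ∑ k ∈ Finset.univ.erase 0,
      pureKernel (fun x => z t x * e k x) (z t) ∈ separableKernels (Fin d) :=
    smul_mem_separableKernels (sum_mem fun t _ => sum_mem fun k _ => pureKernel_mem _ _)
      (by positivity)
  have h2 : (1 / d : ℝ) • ∑ a : Fin d, ∑ c ∈ Finset.univ.erase a,
      pureKernel (Pi.single a (1 : ℂ)) (Pi.single c 1) ∈ separableKernels (Fin d) :=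
    smul_mem_separableKernels (sum_mem fun t _ => sum_mem fun k _ => pureKernel_mem _ _)
      (by positivity)
  convert add_mem h1 h2 using 1
  funext x y p q
  simp only [Pi.add_apply, Pi.smul_apply, Finset.sum_apply, Complex.real_smul]
  have he : ∑ k ∈ Finset.univ.erase 0, e k x * star (e k y) = (if x = y then (d : ℂ) else 0) - 1 := by
    have h5 : ∀ k, e k x * star (e k y) =
        ZMod.stdAddChar (k * (((x : ℕ) : ZMod d) - ((y : ℕ) : ZMod d))) := by
      intro k
      simp only [e]
      rw [star_stdAddChar, ← AddChar.map_add_eq_mul]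
      congr 1
      ring
    rw [Finset.sum_erase_eq_sub (Finset.mem_univ _)]
    simp only [h5]
    rw [sum_stdAddChar_mul, zero_mul, AddChar.map_zero_eq_one]
    congr 1
    refine if_congr ?_ rfl rfl
    rw [sub_eq_zero, ZMod.natCast_eq_natCast_iff', Nat.mod_eq_of_lt x.2, Nat.mod_eq_of_lt y.2,
      Fin.ext_iff]
  have h3 : ∑ t, ∑ k ∈ Finset.univ.erase 0, pureKernel (fun x => z t x * e k x) (z t) x y p q =
      (if (x = y ∧ p = q) ∨ (x = p ∧ y = q) then (N : ℂ) else 0) *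
        ((if x = y then (d : ℂ) else 0) - 1) := by
    rw [← he, ← hz, Finset.sum_mul_sum]
    refine Finset.sum_congr rfl fun t _ => Finset.sum_congr rfl fun k _ => ?_
    simp only [pureKernel, star_mul']
    ring
  rw [h3, h4]
  push_cast
  have hN' : 1 / ((d : ℂ) * N) * N = 1 / d := by field_simp
  have hd' : 1 / (d : ℂ) * d = 1 := by field_simp
  by_cases h1 : x = y <;> by_cases h2 : p = q <;> by_cases h3 : x = p <;> by_cases h4 : y = q <;>
    simp_all [mul_sub, ← mul_assoc]

/-- Distinct pairs are equidistributed under a uniformly random permutation. -/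
theorem sum_perm_pair {ι : Type*} [Fintype ι] [DecidableEq ι] (f : ι → ι → ℂ) {a c : ι}
    (h : a ≠ c) : (Fintype.card ι * (Fintype.card ι - 1) : ℂ) *
      ∑ σ : Equiv.Perm ι, f (σ a) (σ c) =
      Fintype.card (Equiv.Perm ι) * ∑ x, ∑ y, if x = y then 0 else f x y := by
  have h1 : ∀ x y, x ≠ y → ∑ σ : Equiv.Perm ι, f (σ x) (σ y) =
      ∑ σ : Equiv.Perm ι, f (σ a) (σ c) := by
    intro x y hxy
    let τ : Equiv.Perm ι := Equiv.swap (Equiv.swap a x c) y * Equiv.swap a x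
    have ht1 : τ a = x := by
      have : x ≠ Equiv.swap a x c := by
        intro h2
        have : Equiv.swap a x a = Equiv.swap a x c := by rw [Equiv.swap_apply_left]; exact h2
        exact h ((Equiv.swap a x).injective this)
      simp only [τ, Equiv.Perm.mul_apply, Equiv.swap_apply_left]
      exact Equiv.swap_apply_of_ne_of_ne this hxy
    have ht2 : τ c = y := by simp [τ]
    simpa [ht1, ht2] using
      Equiv.sum_comp (Equiv.mulRight τ) (fun σ : Equiv.Perm ι => f (σ a) (σ c))
  have h2 : ∀ σ : Equiv.Perm ι, ∑ x, ∑ y, (if x = y then 0 else f (σ x) (σ y)) =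
      ∑ x, ∑ y, if x = y then 0 else f x y := by
    intro σ
    rw [← Equiv.sum_comp σ (fun x => ∑ y, if x = y then 0 else f x y)]
    refine Finset.sum_congr rfl fun x _ => ?_
    rw [← Equiv.sum_comp σ (fun y => if σ x = y then 0 else f (σ x) y)]
    simp
  have h3 : ∑ σ : Equiv.Perm ι, ∑ x, ∑ y, (if x = y then 0 else f (σ x) (σ y)) =
      ∑ x : ι, ∑ y : ι, if x = y then 0 else ∑ σ : Equiv.Perm ι, f (σ a) (σ c) := by
    refine Finset.sum_comm.trans (Finset.sum_congr rfl fun x _ =>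
      Finset.sum_comm.trans (Finset.sum_congr rfl fun y _ => ?_))
    by_cases hxy : x = y
    · simp [hxy]
    · simp [hxy, h1 x y hxy]
  have h4 : ∀ S : ℂ, ∑ x : ι, ∑ y : ι, (if x = y then 0 else S) =
      Fintype.card ι * (Fintype.card ι - 1) * S := by
    intro S
    have : ∀ x y : ι, (if x = y then 0 else S) = S - if x = y then S else 0 := by
      intro x y
      split_ifs <;> simp
    simp only [this, Finset.sum_sub_distrib]
    simp
    ring
  rw [← h4, ← h3]
  simp [h2]

theorem sum_perm_single {ι : Type*} [Fintype ι] [DecidableEq ι] (f : ι → ℂ) (a : ι) :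
    (Fintype.card ι : ℂ) * ∑ σ : Equiv.Perm ι, f (σ a) =
      Fintype.card (Equiv.Perm ι) * ∑ x, f x := by
  have h1 : ∀ x, ∑ σ : Equiv.Perm ι, f (σ x) = ∑ σ : Equiv.Perm ι, f (σ a) := by
    intro x
    simpa using
      Equiv.sum_comp (Equiv.mulRight (Equiv.swap a x)) (fun σ : Equiv.Perm ι => f (σ a))
  have h3 : ∑ σ : Equiv.Perm ι, ∑ x, f (σ x) = ∑ x : ι, ∑ σ : Equiv.Perm ι, f (σ a) := by
    rw [Finset.sum_comm]
    exact Finset.sum_congr rfl fun x _ => h1 x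
  simp only [Equiv.sum_comp] at h3
  simpa using h3.symm

/-- The second moments of the mixed ensemble of Fourier-type and monomial matrices, over a uniformly
random permutation: the first summand is the contribution of the Fourier-type matrices
`ω ^ (σ a * b)`, the second one that of the permutation matrices. -/
theorem ensemble_moment {n : ℕ} [NeZero n] (hn : 2 ≤ n) (a c b b' d d' : ZMod n) :
    ((1 - 1 / n) / Fintype.card (Equiv.Perm (ZMod n)) : ℂ) *
        (if (b = b' ∧ d = d') ∨ (b = d ∧ b' = d') then
          ∑ σ : Equiv.Perm (ZMod n), ZMod.stdAddChar (σ a * (b - b') - σ c * (d - d')) else 0)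
      + ((n - 1) / Fintype.card (Equiv.Perm (ZMod n)) : ℂ) * ∑ σ : Equiv.Perm (ZMod n),
          (if (σ a = b ∧ σ a = b') ∧ (σ c = d ∧ σ c = d') then 1 else 0) =
      (if b = b' ∧ d = d' then 1 else 0) * (1 - 1 / n * if a = c then 1 else 0)
        + (if b = d ∧ b' = d' then 1 else 0) * ((if a = c then 1 else 0) - 1 / n) := by
  have hn0 : (n : ℂ) ≠ 0 := by exact_mod_cast NeZero.ne n
  have hn1 : (n : ℂ) - 1 ≠ 0 := by
    rw [sub_ne_zero]
    exact_mod_cast (by omega : n ≠ 1)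
  have hK : (Fintype.card (Equiv.Perm (ZMod n)) : ℂ) ≠ 0 := by
    exact_mod_cast Fintype.card_ne_zero
  have hpair := fun f => sum_perm_pair (ι := ZMod n) f (a := a) (c := c)
  have hsing := fun f => sum_perm_single (ι := ZMod n) f a
  simp only [ZMod.card] at hpair hsing
  by_cases h1 : b = b' ∧ d = d'
  · obtain ⟨rfl, rfl⟩ := h1
    simp only [sub_self, mul_zero, AddChar.map_zero_eq_one, and_self, true_or, if_true,
      Finset.sum_const, Finset.card_univ, nsmul_eq_mul, mul_one, one_mul]
    by_cases hac : a = c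
    · subst hac
      by_cases hbd : b = d
      · subst hbd
        have := hsing (fun x => if x = b then 1 else 0)
        rw [Finset.sum_ite_eq' Finset.univ b, if_pos (Finset.mem_univ _)] at this
        simp only [and_self, if_true]
        field_simp
        linear_combination this
      · rw [Finset.sum_eq_zero]
        · simp only [hbd, if_true, if_false]
          field_simp
          ring
        · intro σ _
          rw [if_neg]
          rintro ⟨h1, h2⟩
          exact hbd (h1.symm.trans h2)
    · by_cases hbd : b = d
      · subst hbd
        rw [Finset.sum_eq_zero]
        · simp only [hac, if_true, if_false]
          field_simp
          ring
        · intro σ _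
          rw [if_neg]
          rintro ⟨h1, h2⟩
          exact hac (σ.injective (h1.trans h2.symm))
      · have := hpair (fun x y => if x = b ∧ y = d then 1 else 0) hac
        have h5 : ∑ x, ∑ y, (if x = y then (0 : ℂ) else if x = b ∧ y = d then 1 else 0) = 1 := by
          rw [Finset.sum_eq_single b]
          · rw [Finset.sum_eq_single d]
            · simp [hbd]
            · intro y _ hy
              simp [hy]
            · simp
          · intro x _ hx
            simp [hx]
          · simp
        rw [h5] at this
        simp only [hac, hbd, if_false]
        field_simp
        linear_combination this
  · have hmono : ∑ σ : Equiv.Perm (ZMod n),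
        (if (σ a = b ∧ σ a = b') ∧ (σ c = d ∧ σ c = d') then (1 : ℂ) else 0) = 0 := by
      refine Finset.sum_eq_zero fun σ _ => if_neg ?_
      rintro ⟨⟨h2, h3⟩, h4, h5⟩
      exact h1 ⟨h2.symm.trans h3, h4.symm.trans h5⟩
    rw [hmono]
    by_cases h2 : b = d ∧ b' = d'
    · obtain ⟨rfl, rfl⟩ := h2
      have hb : b ≠ b' := fun h => h1 ⟨h, h⟩
      simp only [hb, and_self, if_true, if_false, or_true]
      by_cases hac : a = c
      · subst hac
        simp only [sub_self, AddChar.map_zero_eq_one, if_true, Finset.sum_const, Finset.card_univ,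
          nsmul_eq_mul]
        field_simp
        ring
      · have := hpair (fun x y => ZMod.stdAddChar (x * (b - b') - y * (b - b'))) hac
        have h5 : ∑ x : ZMod n, ∑ y : ZMod n,
            (if x = y then (0 : ℂ) else ZMod.stdAddChar (x * (b - b') - y * (b - b'))) = -n := by
          have h6 : ∀ x y : ZMod n,
              (if x = y then (0 : ℂ) else ZMod.stdAddChar (x * (b - b') - y * (b - b'))) =
              ZMod.stdAddChar (x * (b - b')) * ZMod.stdAddChar (y * -(b - b'))
                - if x = y then 1 else 0 := by
            intro x y
            rw [← AddChar.map_add_eq_mul]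
            split_ifs with h
            · subst h
              rw [← mul_add, add_neg_cancel, mul_zero, AddChar.map_zero_eq_one, sub_self]
            · rw [sub_zero]
              congr 1
              ring
          simp only [h6, Finset.sum_sub_distrib, ← Finset.mul_sum, ← Finset.sum_mul]
          rw [sum_stdAddChar_mul, if_neg (sub_ne_zero.mpr hb)]
          simp
        rw [h5] at this
        simp only [hac, if_false]
        field_simp
        have h7 : (n : ℂ) * ((n - 1) * ∑ σ : Equiv.Perm (ZMod n),
            ZMod.stdAddChar (σ a * (b - b') - σ c * (b - b'))) =
            n * -(Fintype.card (Equiv.Perm (ZMod n))) := by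
          linear_combination this
        have h8 := mul_left_cancel₀ hn0 h7
        linear_combination h8
    · simp [h1, h2]

/-- The vertex `(-1/n, -1/n, 1)` is the only one that is not a tensor product of maps of the two
factors. It is the average of `X ↦ ⟨M, X M⟩ M M*` over maximally entangled vectors `M` of Schmidt
rank `m`, that is, matrices with orthogonal rows of equal length. Two kinds of them, with random
phases on rows and columns and a random permutation `σ`, are enough: the rows of the Fourier matrix
picked by `σ` (weight `1 - 1/n`) and those of the permutation matrix (weight `n - 1`). -/
theorem entangled_vertex_mem_separableKernels {m n : ℕ} (hmn : m ≤ n) (hn : 2 ≤ n) :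
    depolarizingKernel (Fin m) (Fin n) (-(1 / (n : ℝ))) (-(1 / (n : ℝ))) 1 ∈
      separableKernels (Fin m × Fin n) := by
  have : NeZero n := ⟨by omega⟩
  obtain ⟨N, _, z, hz⟩ := exists_phases m
  obtain ⟨N', _, y, hy⟩ := exists_phases n
  have hN : (N : ℂ) ≠ 0 := by exact_mod_cast NeZero.ne N
  have hN' : (N' : ℂ) ≠ 0 := by exact_mod_cast NeZero.ne N'
  have hK : (Fintype.card (Equiv.Perm (ZMod n)) : ℂ) ≠ 0 := by
    exact_mod_cast Fintype.card_ne_zero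
  have hn' : (2 : ℝ) ≤ n := by exact_mod_cast hn
  let i : Fin m → ZMod n := fun a => ((a : ℕ) : ZMod n)
  let j : Fin n → ZMod n := fun b => ((b : ℕ) : ZMod n)
  have hi : ∀ a c, i a = i c ↔ a = c := by
    intro a c
    simp only [i]
    rw [ZMod.natCast_eq_natCast_iff', Nat.mod_eq_of_lt (by omega), Nat.mod_eq_of_lt (by omega),
      Fin.ext_iff]
  have hj : ∀ a c, j a = j c ↔ a = c := by
    intro a c
    simp only [j]
    rw [ZMod.natCast_eq_natCast_iff', Nat.mod_eq_of_lt a.2, Nat.mod_eq_of_lt c.2, Fin.ext_iff]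
  let F : ZMod N → ZMod N' → Equiv.Perm (ZMod n) → Fin m × Fin n → ℂ := fun t t' σ x =>
    z t x.1 * y t' x.2 * ZMod.stdAddChar (σ (i x.1) * j x.2)
  let G : ZMod N → Equiv.Perm (ZMod n) → Fin m × Fin n → ℂ := fun t σ x =>
    z t x.1 * if σ (i x.1) = j x.2 then 1 else 0
  have h1 : ((1 - 1 / n) / (N * N' * Fintype.card (Equiv.Perm (ZMod n))) : ℝ) •
      ∑ t, ∑ t', ∑ σ, pureKernel (F t t' σ) (F t t' σ) ∈ separableKernels (Fin m × Fin n) := by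
    refine smul_mem_separableKernels (sum_mem fun t _ => sum_mem fun t' _ => sum_mem fun σ _ =>
      pureKernel_mem _ _) (div_nonneg ?_ (by positivity))
    rw [sub_nonneg, div_le_one (by linarith)]
    linarith
  have h2 : ((n - 1) / (N * Fintype.card (Equiv.Perm (ZMod n))) : ℝ) •
      ∑ t, ∑ σ, pureKernel (G t σ) (G t σ) ∈ separableKernels (Fin m × Fin n) :=
    smul_mem_separableKernels (sum_mem fun t _ => sum_mem fun σ _ => pureKernel_mem _ _)
      (div_nonneg (by linarith) (by positivity))
  convert add_mem h1 h2 using 1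
  funext ⟨a, b⟩ ⟨a', b'⟩ ⟨c, d⟩ ⟨c', d'⟩
  simp only [Pi.add_apply, Pi.smul_apply, Finset.sum_apply, Complex.real_smul]
  have h3 : ∑ t, ∑ t', ∑ σ, pureKernel (F t t' σ) (F t t' σ) (a, b) (a', b') (c, d) (c', d') =
      (if (a = a' ∧ c = c') ∨ (a = c ∧ a' = c') then (N : ℂ) else 0) *
      ((if (b = b' ∧ d = d') ∨ (b = d ∧ b' = d') then (N' : ℂ) else 0) *
      ∑ σ : Equiv.Perm (ZMod n), ZMod.stdAddChar (σ (i a) * j b - σ (i a') * j b'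
        - σ (i c) * j d + σ (i c') * j d')) := by
    rw [← hz, ← hy, Finset.sum_mul_sum, Finset.sum_mul_sum]
    refine Finset.sum_congr rfl fun t _ => ?_
    simp only [Finset.mul_sum]
    refine Finset.sum_congr rfl fun t' _ => Finset.sum_congr rfl fun σ _ => ?_
    have h5 : ZMod.stdAddChar (σ (i a) * j b - σ (i a') * j b' - σ (i c) * j d + σ (i c') * j d') =
        ZMod.stdAddChar (σ (i a) * j b) * star (ZMod.stdAddChar (σ (i a') * j b')) *
        (star (ZMod.stdAddChar (σ (i c) * j d)) * ZMod.stdAddChar (σ (i c') * j d')) := by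
      rw [star_stdAddChar, star_stdAddChar, ← AddChar.map_add_eq_mul, ← AddChar.map_add_eq_mul,
        ← AddChar.map_add_eq_mul]
      congr 1
      ring
    rw [h5]
    simp only [F, pureKernel, star_mul']
    ring
  have h4 : ∑ t, ∑ σ, pureKernel (G t σ) (G t σ) (a, b) (a', b') (c, d) (c', d') =
      (if (a = a' ∧ c = c') ∨ (a = c ∧ a' = c') then (N : ℂ) else 0) *
      ∑ σ : Equiv.Perm (ZMod n),
        (if (σ (i a) = j b ∧ σ (i a') = j b') ∧ (σ (i c) = j d ∧ σ (i c') = j d')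
          then 1 else 0) := by
    rw [← hz, Finset.sum_mul_sum]
    refine Finset.sum_congr rfl fun t _ => Finset.sum_congr rfl fun σ _ => ?_
    simp only [G, pureKernel, star_mul', apply_ite star, star_one, star_zero]
    by_cases e1 : σ (i a) = j b <;> by_cases e2 : σ (i a') = j b' <;>
      by_cases e3 : σ (i c) = j d <;> by_cases e4 : σ (i c') = j d' <;> simp [e1, e2, e3, e4]
  rw [h3, h4]
  have hsum : ∀ (B : Prop) [Decidable B] (S T : ℂ),
      (((1 - 1 / n) / (N * N' * Fintype.card (Equiv.Perm (ZMod n))) : ℝ) : ℂ) *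
        (N * ((if B then (N' : ℂ) else 0) * S)) +
      (((n - 1) / (N * Fintype.card (Equiv.Perm (ZMod n))) : ℝ) : ℂ) * (N * T) =
      (1 - 1 / n) / Fintype.card (Equiv.Perm (ZMod n)) * (if B then S else 0)
        + (n - 1) / Fintype.card (Equiv.Perm (ZMod n)) * T := by
    intro B _ S T
    push_cast
    have hn0 : (n : ℂ) ≠ 0 := by exact_mod_cast NeZero.ne n
    split_ifs
    · field_simp
    · field_simp
      ring
  simp only [depolarizingKernel]
  by_cases hA : a = a' ∧ c = c'
  · obtain ⟨rfl, rfl⟩ := hA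
    have key := ensemble_moment hn (i a) (i c) (j b) (j b') (j d) (j d')
    simp only [hi, hj] at key
    have h5 : ∀ σ : Equiv.Perm (ZMod n), σ (i a) * j b - σ (i a) * j b' - σ (i c) * j d
        + σ (i c) * j d' = σ (i a) * (j b - j b') - σ (i c) * (j d - j d') := fun σ => by ring
    simp only [h5, and_self, true_or, if_true]
    rw [hsum, key]
    push_cast
    ring
  · by_cases hA' : a = c ∧ a' = c'
    · -- Exchanging the roles of `y` and `p` reduces this case to the previous one.
      obtain ⟨rfl, rfl⟩ := hA'
      have key := ensemble_moment hn (i a) (i a') (j b) (j d) (j b') (j d')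
      simp only [hi, hj] at key
      have h5 : ∀ σ : Equiv.Perm (ZMod n), σ (i a) * j b - σ (i a') * j b' - σ (i a) * j d
          + σ (i a') * j d' = σ (i a) * (j b - j d) - σ (i a') * (j b' - j d') := fun σ => by ring
      simp only [h5, and_self, or_true, if_true]
      rw [hsum]
      have h6 : ∀ σ : Equiv.Perm (ZMod n), ((σ (i a) = j b ∧ σ (i a') = j b') ∧
          (σ (i a) = j d ∧ σ (i a') = j d')) ↔ ((σ (i a) = j b ∧ σ (i a) = j d) ∧
          (σ (i a') = j b' ∧ σ (i a') = j d')) := fun σ => and_and_and_comm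
      simp only [h6, or_comm (a := b = b' ∧ d = d')]
      rw [key]
      push_cast
      ring
    · simp [hA, hA']

/-! ### Geometry of the solid -/

theorem mem_ebSolid_vec {m n : ℕ} {α β γ : ℝ} : ![α, β, γ] ∈ ebSolid m n ↔
    -(1 / (n : ℝ)) ≤ α ∧ 0 ≤ 1 + (n : ℝ) * α + (m : ℝ) * β + (m : ℝ) * (n : ℝ) * γ ∧
    0 ≤ 1 - α + β - γ ∧ 0 ≤ 1 + α - β - γ ∧ 0 ≤ 1 - α - β + γ ∧
    0 ≤ ((m : ℝ) * (n : ℝ) - 1) * ((m : ℝ) * β + 1)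
      - ((n : ℝ) - (m : ℝ)) * (α + (m : ℝ) * γ) := Iff.rfl

theorem convex_ebSolid (m n : ℕ) : Convex ℝ (ebSolid m n) := by
  rintro x ⟨h1, h2, h3, h4, h5, h6⟩ y ⟨k1, k2, k3, k4, k5, k6⟩ s t hs ht hst
  obtain rfl : t = 1 - s := by linarith
  refine ⟨?_, ?_, ?_, ?_, ?_, ?_⟩ <;> simp only [Pi.add_apply, Pi.smul_apply, smul_eq_mul]
  · linarith [mul_le_mul_of_nonneg_left h1 hs, mul_le_mul_of_nonneg_left k1 ht]
  · linarith [mul_nonneg hs h2, mul_nonneg ht k2]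
  · linarith [mul_nonneg hs h3, mul_nonneg ht k3]
  · linarith [mul_nonneg hs h4, mul_nonneg ht k4]
  · linarith [mul_nonneg hs h5, mul_nonneg ht k5]
  · linarith [mul_nonneg hs h6, mul_nonneg ht k6]

/-- A point with nonnegative barycentric coordinates lies in the tetrahedron. -/
theorem mem_convexHull_four {E : Type*} [AddCommGroup E] [Module ℝ E] {u v w p x : E}
    {a b c d : ℝ} (ha : 0 ≤ a) (hb : 0 ≤ b) (hc : 0 ≤ c) (hd : 0 ≤ d) (h : a + b + c + d = 1)
    (hx : x = a • u + b • v + c • w + d • p) : x ∈ convexHull ℝ {u, v, w, p} := by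
  rw [hx]
  have := (convex_convexHull ℝ {u, v, w, p}).sum_mem (t := Finset.univ) (w := ![a, b, c, d])
    (z := ![u, v, w, p]) (by simp [Fin.forall_fin_succ, *]) (by simpa [Fin.sum_univ_four] using h)
    (fun i _ => subset_convexHull ℝ _ (by fin_cases i <;> simp))
  simpa [Fin.sum_univ_four] using this

theorem mem_convexHull_three {E : Type*} [AddCommGroup E] [Module ℝ E] {u v w x : E}
    {a b c : ℝ} (ha : 0 ≤ a) (hb : 0 ≤ b) (hc : 0 ≤ c) (h : a + b + c = 1)
    (hx : x = a • u + b • v + c • w) : x ∈ convexHull ℝ {u, v, w} := by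
  rw [hx]
  have := (convex_convexHull ℝ {u, v, w}).sum_mem (t := Finset.univ) (w := ![a, b, c])
    (z := ![u, v, w]) (by simp [Fin.forall_fin_succ, *]) (by simpa [Fin.sum_univ_three] using h)
    (fun i _ => subset_convexHull ℝ _ (by fin_cases i <;> simp))
  simpa [Fin.sum_univ_three] using this

/-- An affine function that is nonnegative on a set is nonnegative on its convex hull. -/
theorem nonneg_of_mem_convexHull {s : Set (Fin 3 → ℝ)} {k l₀ l₁ l₂ : ℝ}
    (h : ∀ x ∈ s, 0 ≤ k + l₀ * x 0 + l₁ * x 1 + l₂ * x 2) {x : Fin 3 → ℝ}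
    (hx : x ∈ convexHull ℝ s) : 0 ≤ k + l₀ * x 0 + l₁ * x 1 + l₂ * x 2 := by
  have hc : Convex ℝ {x : Fin 3 → ℝ | 0 ≤ k + l₀ * x 0 + l₁ * x 1 + l₂ * x 2} := by
    intro x hx y hy s t hs ht hst
    obtain rfl : t = 1 - s := by linarith
    simp only [Set.mem_ofPred_eq, Pi.add_apply, Pi.smul_apply, smul_eq_mul] at *
    linarith [mul_nonneg hs hx, mul_nonneg ht hy]
  exact convexHull_min h hc hx

/-- Four points are affinely independent when the linear system for the coefficients of an affine
dependence among them has only the trivial solution. -/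
theorem affineIndependent_four {u v w p : Fin 3 → ℝ}
    (h : ∀ a b c d : ℝ, a + b + c + d = 0 →
      (∀ i, a * u i + b * v i + c * w i + d * p i = 0) → a = 0 ∧ b = 0 ∧ c = 0 ∧ d = 0) :
    AffineIndependent ℝ ![u, v, w, p] := by
  rw [affineIndependent_iff]
  intro s f hf hs i hi
  let g : Fin 4 → ℝ := fun i => if i ∈ s then f i else 0
  have hg : ∑ i, g i = 0 := by simpa [g] using hf
  have hg' : ∑ i, g i • ![u, v, w, p] i = 0 := by simpa [g, ite_smul] using hs
  have h4 := h (g 0) (g 1) (g 2) (g 3) (by simpa [Fin.sum_univ_four] using hg) fun j => by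
    simpa [Fin.sum_univ_four] using congrFun hg' j
  have : g i = 0 := by fin_cases i <;> simp [h4]
  simpa [g, hi] using this

/-- If a point in the interior of a segment lies on a supporting hyperplane, so do the endpoints. -/
theorem eq_zero_of_mem_openSegment {x y z : Fin 3 → ℝ} (hz : z ∈ openSegment ℝ x y)
    {k l₀ l₁ l₂ : ℝ} (h : k + l₀ * z 0 + l₁ * z 1 + l₂ * z 2 = 0)
    (hx : 0 ≤ k + l₀ * x 0 + l₁ * x 1 + l₂ * x 2) (hy : 0 ≤ k + l₀ * y 0 + l₁ * y 1 + l₂ * y 2) :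
    k + l₀ * x 0 + l₁ * x 1 + l₂ * x 2 = 0 := by
  obtain ⟨s, t, hs, ht, hst, rfl⟩ := hz
  obtain rfl : t = 1 - s := by linarith
  simp only [Pi.add_apply, Pi.smul_apply, smul_eq_mul] at h
  have h1 : s * (k + l₀ * x 0 + l₁ * x 1 + l₂ * x 2) = 0 := by
    linarith [mul_nonneg hs.le hx, mul_nonneg ht.le hy]
  exact (mul_eq_zero.mp h1).resolve_left hs.ne'

theorem isTriangularDoublePyramid_ebSolid {m n : ℕ} (hm : 2 ≤ m) (hmn : m ≤ n) :
    IsTriangularDoublePyramid (ebSolid m n)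
      ![-(1 / (n : ℝ)), -(1 / (n : ℝ)), 1]
      ![1, -(1 / (m : ℝ)), -(1 / (m : ℝ))]
      ![-(1 / (n : ℝ)), 1, -(1 / (n : ℝ))]
      ![-(1 / (n : ℝ)), -(1 / (m : ℝ)), 1 / ((m : ℝ) * (n : ℝ))]
      ![1, 1, 1] := by
  have hM : (2 : ℝ) ≤ m := by exact_mod_cast hm
  have hMN : (m : ℝ) ≤ n := by exact_mod_cast hmn
  have hconv := convex_ebSolid m n
  have hS : ∀ {α β γ : ℝ}, ![α, β, γ] ∈ ebSolid m n ↔ _ := mem_ebSolid_vec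
  -- From here on only the six inequalities and the coordinates of the five points matter, and the
  -- dimensions may be treated as real numbers.
  generalize hu : (![-(1 / (n : ℝ)), -(1 / (n : ℝ)), 1] : Fin 3 → ℝ) = u
  generalize hv : (![1, -(1 / (m : ℝ)), -(1 / (m : ℝ))] : Fin 3 → ℝ) = v
  generalize hw : (![-(1 / (n : ℝ)), 1, -(1 / (n : ℝ))] : Fin 3 → ℝ) = w
  generalize hp : (![-(1 / (n : ℝ)), -(1 / (m : ℝ)), 1 / ((m : ℝ) * (n : ℝ))] : Fin 3 → ℝ) = p
  generalize hq : (![1, 1, 1] : Fin 3 → ℝ) = q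
  generalize ebSolid m n = S at *
  generalize (m : ℝ) = M at *
  generalize (n : ℝ) = N at *
  have hM0 : 0 < M := by linarith
  have hN0 : 0 < N := by linarith
  have hM1 : 0 < M - 1 := by linarith
  have hN1 : 0 < N - 1 := by linarith
  have hM2 : 0 < M + 1 := by linarith
  have hN2 : 0 < N + 1 := by linarith
  have hMN1 : 0 < M * N - 1 := by nlinarith
  have hx0 : ∀ x : Fin 3 → ℝ, x = ![x 0, x 1, x 2] := fun x => by
    ext i; fin_cases i <;> rfl
  -- The affine function vanishing on the basis of the double pyramid.
  let h : (Fin 3 → ℝ) → ℝ := fun x =>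
    (M * N - M - 2) + (-(M * N - M + 2 * N)) * x 0 + (-(M * (N + 1))) * x 1 + (-(M * (N + 1))) * x 2
  have huS : u ∈ S := by
    rw [← hu, hS]
    refine ⟨le_rfl, ?_, ?_, ?_, ?_, ?_⟩
    · have : 1 + N * -(1 / N) + M * -(1 / N) + M * N * 1 = M * ((N - 1) * (N + 1)) / N := by
        field_simp; ring
      rw [this]; positivity
    · linarith
    · linarith
    · have : 0 < 1 / N := by positivity
      linarith
    · refine le_of_eq ?_
      field_simp; ring
  have hvS : v ∈ S := by
    rw [← hv, hS]
    have h1 : 0 < 1 / N := by positivity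
    have h2 : 0 < 1 / M := by positivity
    refine ⟨by linarith, ?_, by linarith, by linarith, by linarith, ?_⟩
    · refine le_of_eq ?_
      field_simp; ring
    · refine le_of_eq ?_
      field_simp; ring
  have hwS : w ∈ S := by
    rw [← hw, hS]
    have h1 : 0 < 1 / N := by positivity
    refine ⟨le_rfl, ?_, by linarith, by linarith, by linarith, ?_⟩
    · refine le_of_eq ?_
      field_simp; ring
    · have : (M * N - 1) * (M * 1 + 1) - (N - M) * (-(1 / N) + M * -(1 / N)) =
          M * (M + 1) * ((N - 1) * (N + 1)) / N := by
        field_simp; ring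
      rw [this]; positivity
  have hpS : p ∈ S := by
    rw [← hp, hS]
    refine ⟨le_rfl, ?_, ?_, ?_, ?_, ?_⟩
    · refine le_of_eq ?_
      field_simp; ring
    · have : 1 - -(1 / N) + -(1 / M) - 1 / (M * N) = (N + 1) * (M - 1) / (M * N) := by
        field_simp; ring
      rw [this]; positivity
    · have : 1 + -(1 / N) - -(1 / M) - 1 / (M * N) = (N - 1) * (M + 1) / (M * N) := by
        field_simp; ring
      rw [this]; positivity
    · have : 1 - -(1 / N) - -(1 / M) + 1 / (M * N) = (N + 1) * (M + 1) / (M * N) := by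
        field_simp; ring
      rw [this]; positivity
    · refine le_of_eq ?_
      field_simp; ring
  have hqS : q ∈ S := by
    rw [← hq, hS]
    have h1 : 0 < 1 / N := by positivity
    refine ⟨by linarith, by positivity, by linarith, by linarith, by linarith, ?_⟩
    have : (M * N - 1) * (M * 1 + 1) - (N - M) * (1 + M * 1) = (M + 1) * ((M - 1) * (N + 1)) := by
      ring
    rw [this]; positivity
  -- The value of `h` at the five points.
  have h_u : h u = 0 := by
    simp only [h, ← hu, Matrix.cons_val_zero, Matrix.cons_val_one, Matrix.cons_val]
    field_simp; ring
  have h_v : h v = 0 := by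
    simp only [h, ← hv, Matrix.cons_val_zero, Matrix.cons_val_one, Matrix.cons_val]
    field_simp; ring
  have h_w : h w = 0 := by
    simp only [h, ← hw, Matrix.cons_val_zero, Matrix.cons_val_one, Matrix.cons_val]
    field_simp; ring
  have h_p : h p = (M + 1) * ((N - 1) * (N + 1)) / N := by
    simp only [h, ← hp, Matrix.cons_val_zero, Matrix.cons_val_one, Matrix.cons_val]
    field_simp; ring
  have h_q : h q = -(2 * ((N + 1) * (M + 1))) := by
    simp only [h, ← hq, Matrix.cons_val_zero, Matrix.cons_val_one, Matrix.cons_val]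
    ring
  -- Barycentric coordinates with respect to the two tetrahedra.
  have bary_p : ∀ α β γ : ℝ, ![α, β, γ] =
      (N * (1 + N * α + M * β + M * N * γ) / (M * ((N - 1) * (N + 1)))) • u
      + ((1 + N * α) / (N + 1)) • v
      + (N * ((M * N - 1) * (M * β + 1) - (N - M) * (α + M * γ))
          / ((M + 1) * M * ((N - 1) * (N + 1)))) • w
      + (N * h ![α, β, γ] / ((M + 1) * ((N - 1) * (N + 1)))) • p := by
    intro α β γ
    ext i
    fin_cases i <;> simp [← hu, ← hv, ← hw, ← hp, h] <;> field_simp <;> ring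
  have bary_p_sum : ∀ α β γ : ℝ,
      (N * (1 + N * α + M * β + M * N * γ) / (M * ((N - 1) * (N + 1))))
      + ((1 + N * α) / (N + 1))
      + (N * ((M * N - 1) * (M * β + 1) - (N - M) * (α + M * γ))
          / ((M + 1) * M * ((N - 1) * (N + 1))))
      + (N * h ![α, β, γ] / ((M + 1) * ((N - 1) * (N + 1)))) = 1 := by
    intro α β γ
    simp [h]
    field_simp
    ring
  have bary_q : ∀ α β γ : ℝ, ![α, β, γ] =
      (N * (1 - α - β + γ) / (2 * (N + 1))) • u + (M * (1 + α - β - γ) / (2 * (M + 1))) • v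
      + (N * (1 - α + β - γ) / (2 * (N + 1))) • w
      + (-h ![α, β, γ] / (2 * ((N + 1) * (M + 1)))) • q := by
    intro α β γ
    ext i
    fin_cases i <;> simp [← hu, ← hv, ← hw, ← hq, h] <;> field_simp <;> ring
  have bary_q_sum : ∀ α β γ : ℝ,
      (N * (1 - α - β + γ) / (2 * (N + 1))) + (M * (1 + α - β - γ) / (2 * (M + 1)))
      + (N * (1 - α + β - γ) / (2 * (N + 1)))
      + (-h ![α, β, γ] / (2 * ((N + 1) * (M + 1)))) = 1 := by
    intro α β γ
    simp [h]
    field_simp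
    ring
  have ha1 : ∀ α : ℝ, -(1 / N) ≤ α → 0 ≤ 1 + N * α := by
    intro α hα
    have := mul_le_mul_of_nonneg_left hα hN0.le
    have h2 : N * -(1 / N) = -1 := by field_simp
    linarith
  have mem_p : ∀ x ∈ S, 0 ≤ h x → x ∈ convexHull ℝ {u, v, w, p} := by
    intro x hx hhx
    rw [hx0 x] at hx hhx ⊢
    obtain ⟨h1, h2, h3, h4, h5, h6⟩ := hS.mp hx
    have := ha1 _ h1
    refine mem_convexHull_four ?_ ?_ ?_ ?_ (bary_p_sum _ _ _) (bary_p _ _ _) <;> positivity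
  have mem_q : ∀ x ∈ S, h x ≤ 0 → x ∈ convexHull ℝ {u, v, w, q} := by
    intro x hx hhx
    rw [hx0 x] at hx hhx ⊢
    obtain ⟨h1, h2, h3, h4, h5, h6⟩ := hS.mp hx
    rw [← neg_nonneg] at hhx
    refine mem_convexHull_four ?_ ?_ ?_ ?_ (bary_q_sum _ _ _) (bary_q _ _ _) <;> positivity
  have sub_p : convexHull ℝ {u, v, w, p} ⊆ S := convexHull_min (by
    rintro x (rfl | rfl | rfl | rfl) <;> assumption) hconv
  have sub_q : convexHull ℝ {u, v, w, q} ⊆ S := convexHull_min (by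
    rintro x (rfl | rfl | rfl | rfl) <;> assumption) hconv
  have hunion : S = convexHull ℝ {u, v, w, p} ∪ convexHull ℝ {u, v, w, q} := by
    refine Set.Subset.antisymm (fun x hx => ?_) (Set.union_subset sub_p sub_q)
    rcases le_total 0 (h x) with hh | hh
    · exact Or.inl (mem_p x hx hh)
    · exact Or.inr (mem_q x hx hh)
  refine ⟨hconv, ?_, ?_, hunion, ?_, ?_⟩
  · refine affineIndependent_four fun a b c d hsum hlin => ?_
    have e0 := hlin 0
    have e1 := hlin 1
    have e2 := hlin 2
    simp only [← hu, ← hv, ← hw, ← hp, Matrix.cons_val_zero, Matrix.cons_val_one,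
      Matrix.cons_val] at e0 e1 e2
    field_simp at e0 e1 e2
    have hb : b * (N + 1) = 0 := by linear_combination e0 + hsum
    have hb0 := (mul_eq_zero.mp hb).resolve_right hN2.ne'
    subst hb0
    have ha : a * (M * ((N - 1) * (N + 1))) = 0 := by linear_combination N * e2 + e1
    have ha0 := (mul_eq_zero.mp ha).resolve_right (by positivity)
    subst ha0
    have hc : c * (M + 1) = 0 := by linear_combination hsum - e2
    have hc0 := (mul_eq_zero.mp hc).resolve_right hM2.ne'
    exact ⟨rfl, rfl, hc0, by linarith⟩
  · refine affineIndependent_four fun a b c d hsum hlin => ?_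
    have e0 := hlin 0
    have e1 := hlin 1
    have e2 := hlin 2
    simp only [← hu, ← hv, ← hw, ← hq, Matrix.cons_val_zero, Matrix.cons_val_one,
      Matrix.cons_val] at e0 e1 e2
    have ha : a * (2 * (1 + 1 / N)) = 0 := by linear_combination hsum - e0 - e1 + e2
    have hb : b * (2 * (1 + 1 / M)) = 0 := by linear_combination hsum + e0 - e1 - e2
    have hc : c * (2 * (1 + 1 / N)) = 0 := by linear_combination hsum - e0 + e1 - e2
    have ha0 := (mul_eq_zero.mp ha).resolve_right (by positivity)
    have hb0 := (mul_eq_zero.mp hb).resolve_right (by positivity)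
    have hc0 := (mul_eq_zero.mp hc).resolve_right (by positivity)
    exact ⟨ha0, hb0, hc0, by linarith⟩
  · refine Set.Subset.antisymm ?_ (Set.subset_inter (convexHull_mono ?_) (convexHull_mono ?_))
    · rintro x ⟨hxp, hxq⟩
      have hx := sub_p hxp
      have k1 : 0 ≤ h x := nonneg_of_mem_convexHull (by
        rintro x (rfl | rfl | rfl | rfl)
        · exact h_u.ge
        · exact h_v.ge
        · exact h_w.ge
        · change 0 ≤ h _
          rw [h_p]; positivity) hxp
      have k2 : 0 ≤ -(M * N - M - 2) + (M * N - M + 2 * N) * x 0 + (M * (N + 1)) * x 1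
          + (M * (N + 1)) * x 2 := nonneg_of_mem_convexHull (by
        have hneg : ∀ y, -(M * N - M - 2) + (M * N - M + 2 * N) * y 0 + (M * (N + 1)) * y 1
          + (M * (N + 1)) * y 2 = -h y := fun y => by simp only [h]; ring
        rintro x (rfl | rfl | rfl | rfl)
        · rw [hneg, h_u, neg_zero]
        · rw [hneg, h_v, neg_zero]
        · rw [hneg, h_w, neg_zero]
        · rw [hneg, h_q, neg_neg]; positivity) hxq
      have k3 : h x = 0 := le_antisymm (by simp only [h]; linarith) k1
      rw [hx0 x] at hx k3 ⊢
      obtain ⟨h1, h2, h3, h4, h5, h6⟩ := hS.mp hx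
      have e1 := bary_q_sum (x 0) (x 1) (x 2)
      have e2 := bary_q (x 0) (x 1) (x 2)
      rw [k3, neg_zero, zero_div, add_zero] at e1
      rw [k3, neg_zero, zero_div, zero_smul, add_zero] at e2
      refine mem_convexHull_three ?_ ?_ ?_ e1 e2 <;> positivity
    · rintro x (rfl | rfl | rfl) <;> simp
    · rintro x (rfl | rfl | rfl) <;> simp
  · refine Set.Subset.antisymm (fun x hx => ?_) ?_
    · have hxS := hx.1
      rw [hunion] at hxS
      rcases hxS with hxT | hxT
      · have := extremePoints_convexHull_subset
          (inter_extremePoints_subset_extremePoints_of_subset sub_p ⟨hxT, hx⟩)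
        rcases this with rfl | rfl | rfl | rfl <;> simp
      · have := extremePoints_convexHull_subset
          (inter_extremePoints_subset_extremePoints_of_subset sub_q ⟨hxT, hx⟩)
        rcases this with rfl | rfl | rfl | rfl <;> simp
    · -- Each of the five points is the only point of the solid on the facets through it.
      have ineq : ∀ x ∈ S, 0 ≤ 1 + N * x 0 + 0 * x 1 + 0 * x 2
          ∧ 0 ≤ 1 + N * x 0 + M * x 1 + M * N * x 2
          ∧ 0 ≤ 1 + -1 * x 0 + 1 * x 1 + -1 * x 2 ∧ 0 ≤ 1 + 1 * x 0 + -1 * x 1 + -1 * x 2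
          ∧ 0 ≤ 1 + -1 * x 0 + -1 * x 1 + 1 * x 2
          ∧ 0 ≤ (M * N - 1) + (-(N - M)) * x 0 + (M * N - 1) * M * x 1 + (-(N - M) * M) * x 2 := by
        intro x hx
        rw [hx0 x] at hx
        obtain ⟨h1, h2, h3, h4, h5, h6⟩ := hS.mp hx
        have := ha1 _ h1
        refine ⟨?_, ?_, ?_, ?_, ?_, ?_⟩ <;> linarith
      rintro z (rfl | rfl | rfl | rfl | rfl) <;>
        refine mem_extremePoints_iff_left.mpr ⟨by assumption, fun x hx y hy hz => ?_⟩ <;>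
        obtain ⟨x1, x2, x3, x4, x5, x6⟩ := ineq x hx <;>
        obtain ⟨y1, y2, y3, y4, y5, y6⟩ := ineq y hy
      · have k1 := eq_zero_of_mem_openSegment hz (by rw [← hu]; simp; field_simp; ring) x1 y1
        have k3 := eq_zero_of_mem_openSegment hz (by rw [← hu]; simp) x3 y3
        have k4 := eq_zero_of_mem_openSegment hz (by rw [← hu]; simp) x4 y4
        have r0 : x 0 = -(1 / N) := by field_simp; linarith
        rw [hx0 x, ← hu, r0, show x 1 = -(1 / N) by linarith, show x 2 = 1 by linarith]
      · have k2 := eq_zero_of_mem_openSegment hz (by rw [← hv]; simp; field_simp; ring) x2 y2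
        have k3 := eq_zero_of_mem_openSegment hz (by rw [← hv]; simp) x3 y3
        have k5 := eq_zero_of_mem_openSegment hz (by rw [← hv]; simp) x5 y5
        have r0 : x 0 = 1 := by linarith
        have r2 : x 2 = x 1 := by linarith
        have r1 : x 1 = -(1 / M) := by
          rw [r0, r2] at k2
          have : (N + 1) * (M * x 1 + 1) = 0 := by linarith
          have := (mul_eq_zero.mp this).resolve_left hN2.ne'
          field_simp
          linarith
        rw [hx0 x, ← hv, r2, r1, r0]
      · have k1 := eq_zero_of_mem_openSegment hz (by rw [← hw]; simp; field_simp; ring) x1 y1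
        have k4 := eq_zero_of_mem_openSegment hz (by rw [← hw]; simp) x4 y4
        have k5 := eq_zero_of_mem_openSegment hz (by rw [← hw]; simp) x5 y5
        have r0 : x 0 = -(1 / N) := by field_simp; linarith
        rw [hx0 x, ← hw, r0, show x 1 = 1 by linarith, show x 2 = -(1 / N) by linarith]
      · have k1 := eq_zero_of_mem_openSegment hz (by rw [← hp]; simp; field_simp; ring) x1 y1
        have k2 := eq_zero_of_mem_openSegment hz (by rw [← hp]; simp; field_simp; ring) x2 y2
        have k6 := eq_zero_of_mem_openSegment hz (by rw [← hp]; simp; field_simp; ring) x6 y6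
        have r0 : x 0 = -(1 / N) := by field_simp; linarith
        have r1 : x 1 = -(1 / M) := by
          have h1 : (1 + M * x 1) * (M * ((N - 1) * (N + 1))) = 0 := by
            linear_combination N * k6 + (N - M) * k2
          have := (mul_eq_zero.mp h1).resolve_right (by positivity)
          field_simp
          linarith
        have r2 : x 2 = 1 / (M * N) := by
          rw [r0, r1] at k2
          field_simp at k2 ⊢
          linarith
        rw [hx0 x, ← hp, r0, r1, r2]
      · have k3 := eq_zero_of_mem_openSegment hz (by rw [← hq]; simp) x3 y3
        have k4 := eq_zero_of_mem_openSegment hz (by rw [← hq]; simp) x4 y4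
        have k5 := eq_zero_of_mem_openSegment hz (by rw [← hq]; simp) x5 y5
        rw [hx0 x, ← hq, show x 0 = 1 by linarith, show x 1 = 1 by linarith,
          show x 2 = 1 by linarith]

/-! ### The solid is the set of entanglement-breaking parameters -/

theorem convex_separable_parameters (m n : ℕ) :
    Convex ℝ {x : Fin 3 → ℝ | depolarizingKernel (Fin m) (Fin n) (x 0) (x 1) (x 2) ∈
      separableKernels (Fin m × Fin n)} := by
  intro x hx y hy s t hs ht hst
  have h := add_mem (smul_mem_separableKernels hx hs) (smul_mem_separableKernels hy ht)
  have hst' : (s : ℂ) + t = 1 := by exact_mod_cast hst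
  change depolarizingKernel (Fin m) (Fin n) ((s • x + t • y) 0) ((s • x + t • y) 1)
    ((s • x + t • y) 2) ∈ separableKernels (Fin m × Fin n)
  convert h using 1
  funext x' y' p q
  simp only [depolarizingKernel, Pi.add_apply, Pi.smul_apply, Complex.real_smul, smul_eq_mul]
  push_cast
  linear_combination (-((if x'.1 = y'.1 ∧ p.1 = q.1 then 1 else 0) *
    (if x'.2 = y'.2 ∧ p.2 = q.2 then 1 else 0) : ℂ)) * hst'

/-- The vertices of the solid are entanglement-breaking, hence so is every point of it. -/
theorem separable_of_mem_ebSolid {m n : ℕ} (hm : 2 ≤ m) (hmn : m ≤ n) {x : Fin 3 → ℝ}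
    (hx : x ∈ ebSolid m n) : depolarizingKernel (Fin m) (Fin n) (x 0) (x 1) (x 2) ∈
      separableKernels (Fin m × Fin n) := by
  have : NeZero m := ⟨by omega⟩
  have : NeZero n := ⟨by omega⟩
  have hm0 : (m : ℂ) ≠ 0 := by exact_mod_cast NeZero.ne m
  have hn0 : (n : ℂ) ≠ 0 := by exact_mod_cast NeZero.ne n
  have hconv := convex_separable_parameters m n
  set T := {x : Fin 3 → ℝ | depolarizingKernel (Fin m) (Fin n) (x 0) (x 1) (x 2) ∈
      separableKernels (Fin m × Fin n)} with hT
  have hu : ![-(1 / (n : ℝ)), -(1 / (n : ℝ)), 1] ∈ T :=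
    entangled_vertex_mem_separableKernels hmn (hm.trans hmn)
  have hv : ![1, -(1 / (m : ℝ)), -(1 / (m : ℝ))] ∈ T := by
    change depolarizingKernel (Fin m) (Fin n) 1 (-(1 / (m : ℝ))) (-(1 / (m : ℝ))) ∈
      separableKernels (Fin m × Fin n)
    convert mul_mem_separableKernels (sub_mem_separableKernels m) (add_mem_separableKernels n)
      using 1
    funext x y p q
    simp only [depolarizingKernel]
    push_cast
    ring
  have hw : ![-(1 / (n : ℝ)), 1, -(1 / (n : ℝ))] ∈ T := by
    change depolarizingKernel (Fin m) (Fin n) (-(1 / (n : ℝ))) 1 (-(1 / (n : ℝ))) ∈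
      separableKernels (Fin m × Fin n)
    convert mul_mem_separableKernels (add_mem_separableKernels m) (sub_mem_separableKernels n)
      using 1
    funext x y p q
    simp only [depolarizingKernel]
    push_cast
    ring
  have hp : ![-(1 / (n : ℝ)), -(1 / (m : ℝ)), 1 / ((m : ℝ) * (n : ℝ))] ∈ T := by
    change depolarizingKernel (Fin m) (Fin n) (-(1 / (n : ℝ))) (-(1 / (m : ℝ)))
      (1 / ((m : ℝ) * (n : ℝ))) ∈
      separableKernels (Fin m × Fin n)
    convert mul_mem_separableKernels (sub_mem_separableKernels m) (sub_mem_separableKernels n)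
      using 1
    funext x y p q
    simp only [depolarizingKernel]
    push_cast
    rw [← one_div_mul_one_div]
    ring
  have hq : ![1, 1, 1] ∈ T := by
    change depolarizingKernel (Fin m) (Fin n) 1 1 1 ∈
      separableKernels (Fin m × Fin n)
    convert mul_mem_separableKernels (add_mem_separableKernels m) (add_mem_separableKernels n)
      using 1
    funext x y p q
    simp only [depolarizingKernel]
    push_cast
    ring
  rw [(isTriangularDoublePyramid_ebSolid hm hmn).2.2.2.1] at hx
  rcases hx with hx | hx
  · exact convexHull_min (by rintro x (rfl | rfl | rfl | rfl) <;> assumption) hconv hx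
  · exact convexHull_min (by rintro x (rfl | rfl | rfl | rfl) <;> assumption) hconv hx

theorem isEntanglementBreaking_iff_mem_ebSolid {m n : ℕ} (hm : 2 ≤ m) (hmn : m ≤ n)
    (α β γ : ℝ) :
    IsEntanglementBreaking (bipartiteDepolarizing m n α β γ) ↔ ![α, β, γ] ∈ ebSolid m n := by
  rw [isEntanglementBreaking_iff, choiKernel_bipartiteDepolarizing]
  exact ⟨mem_ebSolid_of_separable hm hmn, fun h => separable_of_mem_ebSolid hm hmn h⟩

theorem mainTheorem1 (dA dB : ℕ) (hA : 2 ≤ dA) (hAB : dA ≤ dB) :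
    (∀ α β γ : ℝ,
      IsEntanglementBreaking (bipartiteDepolarizing dA dB α β γ) ↔
        α ≥ -(1 / (dB : ℝ)) ∧
        1 + (dB : ℝ) * α + (dA : ℝ) * β + (dA : ℝ) * (dB : ℝ) * γ ≥ 0 ∧
        1 - α + β - γ ≥ 0 ∧
        1 + α - β - γ ≥ 0 ∧
        1 - α - β + γ ≥ 0 ∧
        ((dA : ℝ) * (dB : ℝ) - 1) * ((dA : ℝ) * β + 1)
          - ((dB : ℝ) - (dA : ℝ)) * (α + (dA : ℝ) * γ) ≥ 0) ∧
    (dA = dB → ∀ α β γ : ℝ,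
      IsEntanglementBreaking (bipartiteDepolarizing dA dB α β γ) ↔
        α ≥ -(1 / (dB : ℝ)) ∧
        β ≥ -(1 / (dA : ℝ)) ∧
        1 + (dB : ℝ) * α + (dA : ℝ) * β + (dA : ℝ) * (dB : ℝ) * γ ≥ 0 ∧
        1 - α + β - γ ≥ 0 ∧
        1 + α - β - γ ≥ 0 ∧
        1 - α - β + γ ≥ 0) ∧
    IsTriangularDoublePyramid (ebSolid dA dB)
      ![-(1 / (dB : ℝ)), -(1 / (dB : ℝ)), 1]
      ![1, -(1 / (dA : ℝ)), -(1 / (dA : ℝ))]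
      ![-(1 / (dB : ℝ)), 1, -(1 / (dB : ℝ))]
      ![-(1 / (dB : ℝ)), -(1 / (dA : ℝ)), 1 / ((dA : ℝ) * (dB : ℝ))]
      ![1, 1, 1] := by
  refine ⟨fun α β γ => isEntanglementBreaking_iff_mem_ebSolid hA hAB α β γ, ?_,
    isTriangularDoublePyramid_ebSolid hA hAB⟩
  rintro rfl α β γ
  rw [isEntanglementBreaking_iff_mem_ebSolid hA hAB, mem_ebSolid_vec]
  have hm : (2 : ℝ) ≤ dA := by exact_mod_cast hA
  have hm0 : (0 : ℝ) < dA := by linarith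
  have hm1 : (0 : ℝ) < (dA : ℝ) * dA - 1 := by nlinarith
  -- For equal dimensions the last inequality is a positive multiple of `dA * β + 1 ≥ 0`.
  have h6 : 0 ≤ ((dA : ℝ) * dA - 1) * (dA * β + 1) - ((dA : ℝ) - dA) * (α + dA * γ) ↔
      β ≥ -(1 / (dA : ℝ)) := by
    have h1 : (dA : ℝ) * β + 1 = dA * (β + 1 / dA) := by
      rw [mul_add, mul_one_div_cancel hm0.ne']
    rw [sub_self, zero_mul, sub_zero, mul_nonneg_iff_of_pos_left hm1, h1,
      mul_nonneg_iff_of_pos_left hm0, ge_iff_le, neg_le_iff_add_nonneg]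
  rw [h6]
  tauto
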